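/- For a finite simple graph $G$ and vertex weights $a^*,d^*:V(G)\to\{0,1\}$, the triple $(G,a^*,d^*)$ is a YES-instance of $(1,1)$-Cluster Editing if there are a set $D$ of edges of $G$ and a set $A$ of edges of the complement $\overline{G}$ such that every vertex $v$ is incident with at most $d^*(v)$ edges of $D$ and at most $a^*(v)$ edges of $A$, and $G-D+A$ is a vertex-disjoint union of cliques; otherwise it is a NO-instance. Let $\mathcal G_2$ be the class of all $C_3$-free graphs of maximum degree at most $3$, and let $\mathcal G_3$ be the class of all graphs in $\mathcal G_2$ that contain no $4$-cycle all of whose vertices have degree $3$. Then $(1,1)$-Cluster Editing can be reduced from $\mathcal G_2$ to $\mathcal G_3$ in polynomial time. That is, there is an algorithm which, given any $G\in\mathcal G_2$ with vertex weights $a^*,d^*:V(G)\to\{0,1\}$, runs in time polynomial in $|V(G)|$ and either correctly decides whether $(G,a^*,d^*)$ is a YES-instance or a NO-instance, or outputs a graph $H\in\mathcal G_3$, whose order is bounded by a polynomial in $|V(G)|$, with vertex weights $a',d':V(H)\to\{0,1\}$ such that $(G,a^*,d^*)$ is a YES-instance if and only if $(H,a',d')$ is a YES-instance. -/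

import Mathlib

namespace ClusterEditing

/-! ### A random access machine with step count

The machine model is a structured program for a random access machine: registers and
two-dimensional arrays of natural numbers, with addition and truncated subtraction as the only
arithmetic and a `while` loop.  Every elementary operation costs one unit of time.  There is no
multiplication, so a register holds numbers of `O(t + log m)` bits after `t` steps on inputs with
entries at most `m`, and polynomial time here is polynomial time on Turing machines. -/

/-- The memory of the machine: `reg x` is the content of register `x`, and `arr A i j` is the
content of cell `(i, j)` of array `A`. -/
structure Store where
  reg : ℕ → ℕ
  arr : ℕ → ℕ → ℕ → ℕ

/-- `s.setReg x c` is `s` with register `x` overwritten by `c`. -/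
def Store.setReg (s : Store) (x c : ℕ) : Store where
  reg := fun y => if y = x then c else s.reg y
  arr := s.arr

/-- `s.setArr A i j c` is `s` with cell `(i, j)` of array `A` overwritten by `c`. -/
def Store.setArr (s : Store) (A i j c : ℕ) : Store where
  reg := s.reg
  arr := fun B k l => if B = A ∧ k = i ∧ l = j then c else s.arr B k l

/-- Arithmetic expressions. -/
inductive Expr where
  | const (c : ℕ) : Expr
  | reg (x : ℕ) : Expr
  | read (A : ℕ) (i j : Expr) : Expr
  | add (e f : Expr) : Expr
  | sub (e f : Expr) : Expr

/-- The value of an expression; subtraction is truncated at `0`. -/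
def Expr.eval (s : Store) : Expr → ℕ
  | .const c => c
  | .reg x => s.reg x
  | .read A i j => s.arr A (i.eval s) (j.eval s)
  | .add e f => e.eval s + f.eval s
  | .sub e f => e.eval s - f.eval s

/-- The number of operations needed to evaluate an expression. -/
def Expr.cost : Expr → ℕ
  | .const _ => 1
  | .reg _ => 1
  | .read _ i j => i.cost + j.cost + 1
  | .add e f => e.cost + f.cost + 1
  | .sub e f => e.cost + f.cost + 1

/-- Programs.  A condition `e` is true if its value is not `0`. -/
inductive Prog where
  | skip : Prog
  | set (x : ℕ) (e : Expr) : Prog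
  | write (A : ℕ) (i j e : Expr) : Prog
  | seq (P Q : Prog) : Prog
  | ite (e : Expr) (P Q : Prog) : Prog
  | while (e : Expr) (P : Prog) : Prog

/-- `Runs P s s' t`: program `P`, started in memory `s`, halts in memory `s'` after `t` steps. -/
inductive Runs : Prog → Store → Store → ℕ → Prop where
  | skip (s : Store) : Runs .skip s s 1
  | set (x : ℕ) (e : Expr) (s : Store) :
      Runs (.set x e) s (s.setReg x (e.eval s)) (e.cost + 1)
  | write (A : ℕ) (i j e : Expr) (s : Store) :
      Runs (.write A i j e) s (s.setArr A (i.eval s) (j.eval s) (e.eval s))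
        (i.cost + j.cost + e.cost + 1)
  | seq {P Q : Prog} {s s' s'' : Store} {t t' : ℕ} :
      Runs P s s' t → Runs Q s' s'' t' → Runs (.seq P Q) s s'' (t + t')
  | ite_true {e : Expr} {P Q : Prog} {s s' : Store} {t : ℕ} :
      e.eval s ≠ 0 → Runs P s s' t → Runs (.ite e P Q) s s' (e.cost + 1 + t)
  | ite_false {e : Expr} {P Q : Prog} {s s' : Store} {t : ℕ} :
      e.eval s = 0 → Runs Q s s' t → Runs (.ite e P Q) s s' (e.cost + 1 + t)
  | while_true {e : Expr} {P : Prog} {s s' s'' : Store} {t t' : ℕ} :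
      e.eval s ≠ 0 → Runs P s s' t → Runs (.while e P) s' s'' t' →
        Runs (.while e P) s s'' (e.cost + 1 + t + t')
  | while_false {e : Expr} {P : Prog} {s : Store} :
      e.eval s = 0 → Runs (.while e P) s s (e.cost + 1)

/-! ### Cluster editing -/

/-- A cluster graph (or clique graph) is a vertex-disjoint union of cliques: every connected
component is a clique. -/
def IsClusterGraph {V : Type*} (G : SimpleGraph V) : Prop :=
  ∀ C : G.ConnectedComponent, G.IsClique C.supp

/-- An instance of `(a, d)`-Cluster Editing: a finite graph with vertex weights
`add : V → {0, …, a}` and `del : V → {0, …, d}`. -/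
structure Instance (a d : ℕ) where
  order : ℕ
  graph : SimpleGraph (Fin order)
  add : Fin order → Fin (a + 1)
  del : Fin order → Fin (d + 1)

/-- An instance is a YES-instance if there are a set `D` of edges of the graph `G`, at most `del v`
of them at each vertex `v`, and a set `A` of edges of the complement of `G`, at most `add v` of them
at each vertex `v`, such that `G - D + A` is a cluster graph.  (Edge sets are given as
graphs on the same vertices.) -/
def Instance.IsYes {a d : ℕ} (I : Instance a d) : Prop :=
  ∃ D A : SimpleGraph (Fin I.order), D ≤ I.graph ∧ A ≤ I.graphᶜ ∧
    (∀ v, (D.neighborSet v).ncard ≤ (I.del v : ℕ)) ∧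
    (∀ v, (A.neighborSet v).ncard ≤ (I.add v : ℕ)) ∧
    IsClusterGraph ((I.graph \ D) ⊔ A)

/-! ### Instances as inputs and outputs of the machine -/

open Classical in
/-- The initial memory on input `I`: the number of vertices in register `0`, the adjacency matrix in
array `0`, the weights `add` and `del` in column `0` of arrays `1` and `2`, and `0` elsewhere. -/
noncomputable def Instance.toStore {a d : ℕ} (I : Instance a d) : Store where
  reg := fun x => if x = 0 then I.order else 0
  arr := fun A i j =>
    if A = 0 then
      if ∃ (hi : i < I.order) (hj : j < I.order), I.graph.Adj ⟨i, hi⟩ ⟨j, hj⟩ then 1 else 0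
    else if A = 1 then
      if h : i < I.order ∧ j = 0 then (I.add ⟨i, h.1⟩ : ℕ) else 0
    else if A = 2 then
      if h : i < I.order ∧ j = 0 then (I.del ⟨i, h.1⟩ : ℕ) else 0
    else 0

open Classical in
/-- The memory `s` contains the instance `J`, in the format of the input (other registers and
cells may hold anything). -/
def Store.Contains {a d : ℕ} (s : Store) (J : Instance a d) : Prop :=
  s.reg 0 = J.order ∧
  (∀ i j : Fin J.order, s.arr 0 i j = if J.graph.Adj i j then 1 else 0) ∧
  (∀ i : Fin J.order, s.arr 1 i 0 = (J.add i : ℕ)) ∧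
  (∀ i : Fin J.order, s.arr 2 i 0 = (J.del i : ℕ))

/-- `(a, d)`-Cluster Editing can be reduced from the graph class `𝒢` to the graph class `ℋ` in
polynomial time: some program halts, on every instance `I` whose graph is in `𝒢`, in time
polynomial in the number of vertices of `I`, with a verdict in register `1`, which is either
`0`, and `I` is a NO-instance, or `1`, and `I` is a YES-instance, or `2`, and the memory then
contains an instance `J` with graph in `ℋ`, of polynomial order, that is a YES-instance if and
only if `I` is. -/
def PolyReducible (a d : ℕ) (𝒢 ℋ : ∀ n : ℕ, Set (SimpleGraph (Fin n))) : Prop :=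
  ∃ (P : Prog) (p : Polynomial ℕ), ∀ I : Instance a d, I.graph ∈ 𝒢 I.order →
    ∃ (s : Store) (t : ℕ), Runs P I.toStore s t ∧ t ≤ p.eval I.order ∧
      ((s.reg 1 = 0 ∧ ¬ I.IsYes) ∨
       (s.reg 1 = 1 ∧ I.IsYes) ∨
       (s.reg 1 = 2 ∧ ∃ J : Instance a d, s.Contains J ∧ J.graph ∈ ℋ J.order ∧
          J.order ≤ p.eval I.order ∧ (I.IsYes ↔ J.IsYes)))

/-! ### The two graph classes -/

/-- The triangle-free graphs of maximum degree at most `3`. -/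
def classG2 (n : ℕ) : Set (SimpleGraph (Fin n)) :=
  {G | G.CliqueFree 3 ∧ ∀ v, (G.neighborSet v).ncard ≤ 3}

/-- The triangle-free graphs of maximum degree at most `3` that contain no `4`-cycle all of whose
vertices have degree `3`. -/
def classG3 (n : ℕ) : Set (SimpleGraph (Fin n)) :=
  {G | G ∈ classG2 n ∧
    ¬ ∃ v₁ v₂ v₃ v₄ : Fin n,
      (G.Adj v₁ v₂ ∧ G.Adj v₂ v₃ ∧ G.Adj v₃ v₄ ∧ G.Adj v₄ v₁ ∧ v₁ ≠ v₃ ∧ v₂ ≠ v₄) ∧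
      (G.neighborSet v₁).ncard = 3 ∧ (G.neighborSet v₂).ncard = 3 ∧
      (G.neighborSet v₃).ncard = 3 ∧ (G.neighborSet v₄).ncard = 3}

end ClusterEditing

/-!
In a clustering of a triangle-free graph of maximum degree `3`, with at most one deleted and one added
edge at each vertex, a vertex of degree `3` keeps at least two of its edges.  Hence a `4`-cycle
`v₁ v₂ v₃ v₄` of vertices of degree `3`, with third neighbours `u₁, u₂, u₃, u₄` (a cubic square), has
only three possibilities (`IsClustering.square_cases`): it is a cluster; or `v₁ v₂ u₂ u₁` and
`v₃ v₄ u₄ u₃` are clusters and `4`-cycles; or the same holds with the roles of the two pairs of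
opposite edges exchanged.  In each case all weights at the square must be `1`.

If the `uᵢ` admit neither of the last two possibilities, the edge `v₁u₁` is deleted in every solution,
and can be removed together with the deletion budget of its ends (`clusterable_deleteEdge`).  If
`u₁u₂` and `u₃u₄` are edges, the edges `v₁v₄` and `v₂v₃` are replaced by a path `v₂ z w v₃` through
two new vertices of weight `1` (`bypass`).  The edge `zw` is deleted exactly when `v₂z` and `wv₃` are
both kept; then the clusters `v₁ v₂ z` and `w v₃ v₄` stand for the cluster `v₁ v₂ v₃ v₄` of the old
graph, and otherwise the clusters `v₁ v₂ u₂ u₁` and `v₃ v₄ u₄ u₃` are forced.  The one unwanted case, a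
cluster `u₂ v₂ z`, only occurs if `u₂` and `v₁` have the same neighbours, and then exchanging these
twins repairs it (`IsBypassable.clusterable_bypass_iff`).  Should the square be cuttable in both
directions, it lies in a cube, for which one direction suffices (`IsClustering.flip_cube`).

Both operations destroy the square at hand, create no cubic squares, and keep the graph triangle-free
with maximum degree at most `3`.  So a single pass over all `8`-tuples of original vertices removes
every cubic square; it takes eight nested loops with a body of constant running time
(`forAll_runs`, `reduction_runs`).  Solutions are handled as partitions of the vertices, and graphs as
graphs on `ℕ` with isolated vertices beyond the order, so that vertices can be added without
renaming.
-/

namespace ClusterEditing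

/-! ### Clusterings of graphs with bounded edit degree -/

variable {V : Type*}

/-- `r` is the partition of the vertices into the cliques of an edited graph: every vertex `v` is
incident with at most one edge of `G` that leaves its class, and with none if `d v = 0`, and it has
at most one non-neighbour in its class, and none if `a v = 0`.  The deleted and the added edges are
determined by `r`; weights above `1` count as `1`. -/
structure IsClustering (G : SimpleGraph V) (a d : V → ℕ) (r : V → V → Prop) : Prop where
  equiv : Equivalence r
  cut : ∀ v x, G.Adj v x → ¬ r v x → d v ≠ 0
  cut_unique : ∀ v x y, G.Adj v x → ¬ r v x → G.Adj v y → ¬ r v y → x = y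
  add : ∀ v x, v ≠ x → ¬ G.Adj v x → r v x → a v ≠ 0
  add_unique : ∀ v x y, v ≠ x → ¬ G.Adj v x → r v x → v ≠ y → ¬ G.Adj v y → r v y → x = y

/-- Some partition of the vertices obeys the weights `a` (additions) and `d` (deletions). -/
def Clusterable (G : SimpleGraph V) (a d : V → ℕ) : Prop := ∃ r, IsClustering G a d r

/-- Triangle-free of maximum degree at most `3`; the degree bound says that the neighbours of a vertex
lie among three (not necessarily distinct) vertices. -/
structure IsSubcubic (G : SimpleGraph V) : Prop where
  triangle_free : ∀ x y z, G.Adj x y → G.Adj y z → ¬ G.Adj x z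
  degree_le : ∀ v, ∃ p q s, ∀ x, G.Adj v x → x = p ∨ x = q ∨ x = s

/-- `v₁ v₂ v₃ v₄` is a `4`-cycle and `uᵢ` is a neighbour of `vᵢ` outside the two on the cycle.  In a
graph of maximum degree `3` these are the `4`-cycles all of whose vertices have degree `3`.
Different `uᵢ` may coincide. -/
structure IsCubicSquare (G : SimpleGraph V) (v₁ v₂ v₃ v₄ u₁ u₂ u₃ u₄ : V) : Prop where
  adj₁₂ : G.Adj v₁ v₂
  adj₂₃ : G.Adj v₂ v₃
  adj₃₄ : G.Adj v₃ v₄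
  adj₄₁ : G.Adj v₄ v₁
  ne₁₃ : v₁ ≠ v₃
  ne₂₄ : v₂ ≠ v₄
  adj₁ : G.Adj v₁ u₁
  adj₂ : G.Adj v₂ u₂
  adj₃ : G.Adj v₃ u₃
  adj₄ : G.Adj v₄ u₄
  ne₁₂ : u₁ ≠ v₂
  ne₁₄ : u₁ ≠ v₄
  ne₂₃ : u₂ ≠ v₃
  ne₂₁ : u₂ ≠ v₁
  ne₃₄ : u₃ ≠ v₄
  ne₃₂ : u₃ ≠ v₂
  ne₄₁ : u₄ ≠ v₁
  ne₄₃ : u₄ ≠ v₃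

/-- The partition obtained from `r` by making `S` a class and removing `S` from the other classes. -/
def carve (S : Set V) (r : V → V → Prop) (x y : V) : Prop := (x ∈ S ↔ y ∈ S) ∧ (x ∈ S ∨ r x y)

theorem carve_equivalence (S : Set V) {r : V → V → Prop} (h : Equivalence r) :
    Equivalence (carve S r) where
  refl x := ⟨Iff.rfl, Or.inr (h.refl x)⟩
  symm {x y} hxy := ⟨hxy.1.symm, by have := @h.symm x y; unfold carve at hxy; tauto⟩
  trans {x y z} hxy hyz :=
    ⟨hxy.1.trans hyz.1, by have := @h.trans x y z; unfold carve at hxy hyz; tauto⟩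

namespace IsCubicSquare

variable {G : SimpleGraph V} {v₁ v₂ v₃ v₄ u₁ u₂ u₃ u₄ : V}

theorem rotate (h : IsCubicSquare G v₁ v₂ v₃ v₄ u₁ u₂ u₃ u₄) :
    IsCubicSquare G v₂ v₃ v₄ v₁ u₂ u₃ u₄ u₁ :=
  ⟨h.adj₂₃, h.adj₃₄, h.adj₄₁, h.adj₁₂, h.ne₂₄, h.ne₁₃.symm, h.adj₂, h.adj₃, h.adj₄, h.adj₁,
    h.ne₂₃, h.ne₂₁, h.ne₃₄, h.ne₃₂, h.ne₄₁, h.ne₄₃, h.ne₁₂, h.ne₁₄⟩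

theorem reflect (h : IsCubicSquare G v₁ v₂ v₃ v₄ u₁ u₂ u₃ u₄) :
    IsCubicSquare G v₁ v₄ v₃ v₂ u₁ u₄ u₃ u₂ :=
  ⟨h.adj₄₁.symm, h.adj₃₄.symm, h.adj₂₃.symm, h.adj₁₂.symm, h.ne₁₃, h.ne₂₄.symm, h.adj₁, h.adj₄,
    h.adj₃, h.adj₂, h.ne₁₄, h.ne₁₂, h.ne₄₃, h.ne₄₁, h.ne₃₂, h.ne₃₄, h.ne₂₁, h.ne₂₃⟩

theorem adj_iff (h : IsCubicSquare G v₁ v₂ v₃ v₄ u₁ u₂ u₃ u₄) (hG : IsSubcubic G) (x : V) :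
    G.Adj v₁ x ↔ x = v₂ ∨ x = v₄ ∨ x = u₁ := by
  obtain ⟨p, q, s, hp⟩ := hG.degree_le v₁
  have h1 := hp _ h.adj₁₂
  have h2 := hp _ h.adj₄₁.symm
  have h3 := hp _ h.adj₁
  have := h.ne₂₄
  have := h.ne₁₂
  have := h.ne₁₄
  constructor
  · intro hx
    have := hp _ hx
    grind
  · rintro (rfl | rfl | rfl)
    exacts [h.adj₁₂, h.adj₄₁.symm, h.adj₁]

theorem not_adj (h : IsCubicSquare G v₁ v₂ v₃ v₄ u₁ u₂ u₃ u₄) (hG : IsSubcubic G) :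
    ¬ G.Adj v₁ v₃ := hG.triangle_free _ _ _ h.adj₁₂ h.adj₂₃

end IsCubicSquare

namespace IsClustering

variable {G : SimpleGraph V} {a d : V → ℕ} {r : V → V → Prop}
  {v₁ v₂ v₃ v₄ u₁ u₂ u₃ u₄ : V}

/-- If a vertex shares its class with two of its neighbours `p` and `q`, then every further member of
the class is adjacent to both: `p` and `q` are non-adjacent, so neither may miss another vertex. -/
theorem adj_of_path (hr : IsClustering G a d r) (hG : IsSubcubic G) {v p q y : V}
    (hp : G.Adj v p) (hq : G.Adj v q) (hpq : p ≠ q) (hvp : r v p) (hvq : r v q) (hy : r v y)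
    (hyp : y ≠ p) (hyq : y ≠ q) : G.Adj p y := by
  by_contra hn
  have h1 : ¬ G.Adj p q := fun h => hG.triangle_free _ _ _ hp h hq
  exact hyq (hr.add_unique p y q hyp.symm hn (hr.equiv.trans (hr.equiv.symm hvp) hy) hpq h1
    (hr.equiv.trans (hr.equiv.symm hvp) hvq))

/-- A `4`-cycle contained in a class is the whole class, as a fifth vertex would close a triangle. -/
theorem eq_of_square (hr : IsClustering G a d r) (hG : IsSubcubic G) {v p q x y : V}
    (hp : G.Adj v p) (hq : G.Adj v q) (hpq : p ≠ q) (hpx : G.Adj p x) (hvx : v ≠ x)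
    (hvp : r v p) (hvq : r v q) (hrx : r v x) (hy : r v y) :
    y = v ∨ y = p ∨ y = x ∨ y = q := by
  by_contra! hn
  obtain ⟨h1, h2, h3, h4⟩ := hn
  have h5 := hr.adj_of_path hG hp hq hpq hvp hvq hy h2 h4
  refine h3 (hr.add_unique v y x h1.symm (hG.triangle_free _ _ _ hp h5) hy hvx
    (hG.triangle_free _ _ _ hp hpx) hrx)

/-- At most one edge at a vertex is deleted. -/
theorem rel_or (hr : IsClustering G a d r) {v x y : V} (hx : G.Adj v x) (hy : G.Adj v y)
    (hxy : x ≠ y) : r v x ∨ r v y := by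
  by_contra! h
  exact hxy (hr.cut_unique v x y hx h.1 hy h.2)

/-- If `v₁` keeps both of its edges on a cubic square, the square lies in one class. -/
theorem square_of_rel (hr : IsClustering G a d r) (hG : IsSubcubic G)
    (h : IsCubicSquare G v₁ v₂ v₃ v₄ u₁ u₂ u₃ u₄) (h2 : r v₁ v₂) (h4 : r v₁ v₄) : r v₁ v₃ := by
  have hc := hr.equiv
  rcases hr.rel_or h.adj₂₃ h.adj₂ h.ne₂₃.symm with h3 | h3
  · exact hc.trans h2 h3
  · by_contra hn
    have h5 := hr.adj_of_path hG h.adj₄₁.symm h.adj₁₂ h.ne₂₄.symm h4 h2 (hc.trans h2 h3)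
      (fun h' => hn ?_) h.adj₂.ne'
    · -- cluster v₁ v₂ u₂ v₄ leaves v₃ with two deleted edges
      rcases hr.rel_or h.adj₂₃.symm h.adj₃₄ h.ne₂₄ with h6 | h6
      · exact hn (hc.trans h2 (hc.symm h6))
      · exact hn (hc.trans h4 (hc.symm h6))
    · subst h'
      exact absurd h.adj₂ (h.rotate.not_adj hG)

/-- If a cubic square loses its edge `v₁v₄`, then `v₁v₂` lies in the class of another `4`-cycle
`v₁ v₂ u₂ u₁`. -/
theorem side_of_not_rel (hr : IsClustering G a d r) (hG : IsSubcubic G)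
    (h : IsCubicSquare G v₁ v₂ v₃ v₄ u₁ u₂ u₃ u₄) (h4 : ¬ r v₁ v₄) :
    r v₁ v₂ ∧ r v₁ u₁ ∧ r v₁ u₂ ∧ G.Adj u₁ u₂ := by
  have hc := hr.equiv
  have h2 : r v₁ v₂ := (hr.rel_or h.adj₁₂ h.adj₄₁.symm h.ne₂₄).resolve_right h4
  have h1 : r v₁ u₁ := (hr.rel_or h.adj₁ h.adj₄₁.symm h.ne₁₄).resolve_right h4
  have h3 : ¬ r v₁ v₃ := fun h3 => by
    rcases hr.rel_or h.adj₄₁ h.adj₃₄.symm h.ne₁₃ with h6 | h6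
    · exact h4 (hc.symm h6)
    · exact h4 (hc.trans h3 (hc.symm h6))
  have h5 : r v₂ u₂ := (hr.rel_or h.adj₂ h.adj₂₃ h.ne₂₃).resolve_right
    fun h' => h3 (hc.trans h2 h')
  have h6 : r v₁ u₂ := hc.trans h2 h5
  refine ⟨h2, h1, h6, hr.adj_of_path hG h.adj₁ h.adj₁₂ h.ne₁₂ h1 h2 h6 ?_ h.adj₂.ne'⟩
  rintro rfl
  exact hG.triangle_free _ _ _ h.adj₁₂ h.adj₂ h.adj₁

/-- The trichotomy for a cubic square: it is contained in a class, or it is cut into two opposite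
edges `v₁v₂`, `v₃v₄` (or `v₂v₃`, `v₄v₁`), each of which forms a class together with an edge
between the third neighbours. -/
theorem square_cases (hr : IsClustering G a d r) (hG : IsSubcubic G)
    (h : IsCubicSquare G v₁ v₂ v₃ v₄ u₁ u₂ u₃ u₄) :
    (r v₁ v₂ ∧ r v₁ v₃ ∧ r v₁ v₄) ∨
    (¬ r v₁ v₄ ∧ (r v₁ v₂ ∧ r v₁ u₁ ∧ r v₁ u₂ ∧ G.Adj u₁ u₂) ∧
      (r v₄ v₃ ∧ r v₄ u₄ ∧ r v₄ u₃ ∧ G.Adj u₄ u₃)) ∨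
    (¬ r v₁ v₂ ∧ (r v₁ v₄ ∧ r v₁ u₁ ∧ r v₁ u₄ ∧ G.Adj u₁ u₄) ∧
      (r v₂ v₃ ∧ r v₂ u₂ ∧ r v₂ u₃ ∧ G.Adj u₂ u₃)) := by
  by_cases h2 : r v₁ v₂
  · by_cases h4 : r v₁ v₄
    · exact Or.inl ⟨h2, hr.square_of_rel hG h h2 h4, h4⟩
    · exact Or.inr (Or.inl ⟨h4, hr.side_of_not_rel hG h h4,
        hr.side_of_not_rel hG h.rotate.rotate.rotate.reflect fun h' => h4 (hr.equiv.symm h')⟩)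
  · refine Or.inr (Or.inr ⟨h2, hr.side_of_not_rel hG h.reflect h2,
        hr.side_of_not_rel hG h.rotate fun h' => h2 (hr.equiv.symm h')⟩)

end IsClustering
end ClusterEditing

namespace ClusterEditing

/-! ### Forced deletions and automorphisms -/

variable {V : Type*} {G : SimpleGraph V} {a d : V → ℕ} {r : V → V → Prop}
  {v₁ v₂ v₃ v₄ u₁ u₂ u₃ u₄ : V}

/-- An edge that every clustering deletes can be removed, at the price of the deletion budget of its
ends. -/
theorem clusterable_deleteEdge [DecidableEq V] (hG : IsSubcubic G) {x y : V} (hxy : G.Adj x y)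
    (hcut : ∀ r, IsClustering G a d r → ¬ r x y) :
    Clusterable G a d ↔ d x ≠ 0 ∧ d y ≠ 0 ∧
      Clusterable (G.deleteEdges {s(x, y)}) a (Function.update (Function.update d x 0) y 0) := by
  have hne := hxy.ne
  have hdel : ∀ u v, (G.deleteEdges {s(x, y)}).Adj u v ↔
      G.Adj u v ∧ ¬ (u = x ∧ v = y) ∧ ¬ (u = y ∧ v = x) := by
    intro u v
    simp [SimpleGraph.deleteEdges_adj]
  constructor
  · rintro ⟨r, hr⟩
    have hn := hcut r hr
    have hn' : ¬ r y x := fun h => hn (hr.equiv.symm h)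
    refine ⟨hr.cut x y hxy hn, hr.cut y x hxy.symm hn', r, hr.equiv, ?_, ?_, ?_, ?_⟩
    · intro v u hv hvu
      rw [hdel] at hv
      have h1 := hr.cut v u hv.1 hvu
      have h2 := hr.cut_unique x u y
      have h3 := hr.cut_unique y u x
      have := hxy.symm
      simp only [Function.update_apply]
      grind
    · intro v u w hv hvu hw hvw
      rw [hdel] at hv hw
      exact hr.cut_unique v u w hv.1 hvu hw.1 hvw
    · intro v u hvu hv hrv
      rw [hdel] at hv
      exact hr.add v u hvu (by grind) hrv
    · intro v u w hvu hv hrv hvw hw hrw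
      rw [hdel] at hv hw
      exact hr.add_unique v u w hvu (by grind) hrv hvw (by grind) hrw
  · rintro ⟨hx, hy, r, hr⟩
    have hc := hr.equiv
    have hd : ∀ v, Function.update (Function.update d x 0) y 0 v ≠ 0 → v ≠ x ∧ v ≠ y ∧ d v ≠ 0 := by
      intro v
      simp only [Function.update_apply]
      grind
    -- After the removal `x` and `y` could still share a class; each then misses the other, so a third
    -- member would form a triangle with them, and the class `{x, y}` can be split.
    have hsing : r x y → ∀ u, r x u → u = x ∨ u = y := by
      intro h u hu
      by_contra! hn
      have h1 := hr.add_unique x y u hne (by simp) h hn.1.symm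
      have h2 := hr.add_unique y x u hne.symm (by simp) (hc.symm h) hn.2.symm
      have h3 := hc.trans (hc.symm h) hu
      have := hG.triangle_free x u y
      have := G.adj_comm u y
      simp only [hdel] at h1 h2
      grind
    have hcutx : ∀ u, G.Adj x u → ¬ r x u → u = y := by
      intro u hu hru
      by_contra hn
      exact (hd x (hr.cut x u (by rw [hdel]; grind) hru)).1 rfl
    have hcuty : ∀ u, G.Adj y u → ¬ r y u → u = x := by
      intro u hu hru
      by_contra hn
      exact (hd y (hr.cut y u (by rw [hdel]; grind) hru)).2.1 rfl
    by_cases hrxy : r x y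
    · have hs := hsing hrxy
      have hxu : ∀ u, G.Adj x u → u = y := by
        intro u hu
        by_cases h : r x u
        · have := hs u h
          grind [hu.ne]
        · exact hcutx u hu h
      have hyu : ∀ u, G.Adj y u → u = x := by
        intro u hu
        by_cases h : r y u
        · have := hs u (hc.trans hrxy h)
          grind [hu.ne]
        · exact hcuty u hu h
      refine ⟨carve {x} r, carve_equivalence _ hc, ?_, ?_, ?_, ?_⟩
      · intro v u hv hvu
        simp only [carve, Set.mem_singleton_iff] at hvu
        have h1 := hr.cut v u
        have h2 := hd v
        have := hv.symm
        rw [hdel] at h1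
        grind
      · intro v u w hv hvu hw hvw
        simp only [carve, Set.mem_singleton_iff] at hvu hvw
        have h1 := hr.cut_unique v u w
        have := hv.symm
        have := hw.symm
        simp only [hdel] at h1
        grind
      · intro v u hvu hv hrv
        simp only [carve, Set.mem_singleton_iff] at hrv
        have h1 := hr.add v u
        simp only [hdel] at h1
        grind
      · intro v u w hvu hv hrv hvw hw hrw
        simp only [carve, Set.mem_singleton_iff] at hrv hrw
        have h1 := hr.add_unique v u w
        simp only [hdel] at h1
        grind
    · have hryx : ¬ r y x := fun h => hrxy (hc.symm h)
      refine ⟨r, hc, ?_, ?_, ?_, ?_⟩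
      · intro v u hv hvu
        have h1 := hr.cut v u
        have h2 := hd v
        rw [hdel] at h1
        grind
      · intro v u w hv hvu hw hvw
        have h1 := hr.cut_unique v u w
        simp only [hdel] at h1
        grind
      · intro v u hvu hv hrv
        have h1 := hr.add v u
        simp only [hdel] at h1
        grind
      · intro v u w hvu hv hrv hvw hw hrw
        have h1 := hr.add_unique v u w
        simp only [hdel] at h1
        grind

/-- Clusterings can be transported along automorphisms that do not lose weight. -/
theorem IsClustering.comap {r : V → V → Prop} (hr : IsClustering G a d r) (σ : Equiv.Perm V)
    (hG : ∀ x y, G.Adj (σ x) (σ y) ↔ G.Adj x y) (ha : ∀ x, a (σ x) ≠ 0 → a x ≠ 0)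
    (hd : ∀ x, d (σ x) ≠ 0 → d x ≠ 0) : IsClustering G a d fun x y => r (σ x) (σ y) where
  equiv := hr.equiv.comap σ
  cut v x hv hvx := hd v (hr.cut (σ v) (σ x) ((hG _ _).2 hv) hvx)
  cut_unique v x y hx hrx hy hry :=
    σ.injective (hr.cut_unique _ _ _ ((hG _ _).2 hx) hrx ((hG _ _).2 hy) hry)
  add v x hvx hv hr' := ha v (hr.add (σ v) (σ x) (σ.injective.ne hvx) (by rwa [hG]) hr')
  add_unique v x y hvx hx hrx hvy hy hry :=
    σ.injective (hr.add_unique _ _ _ (σ.injective.ne hvx) (by rwa [hG]) hrx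
      (σ.injective.ne hvy) (by rwa [hG]) hry)

/-- Exchanging two vertices with the same neighbours is an automorphism. -/
theorem adj_swap_iff [DecidableEq V] {x y : V} (h : ∀ t, G.Adj x t ↔ G.Adj y t) (p q : V) :
    G.Adj (Equiv.swap x y p) (Equiv.swap x y q) ↔ G.Adj p q := by
  have key : ∀ p t, G.Adj (Equiv.swap x y p) t ↔ G.Adj p t := by
    intro p t
    rw [Equiv.swap_apply_def]
    split_ifs with h1 h2
    · rw [h1, h]
    · rw [h2, h]
    · rfl
  rw [key, G.adj_comm, key, G.adj_comm]

end ClusterEditing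

namespace ClusterEditing

/-! ### Bypassing a square: the new graph -/

variable {V : Type*} {G : SimpleGraph V} {a d : V → ℕ} {r : V → V → Prop}
  {v₁ v₂ v₃ v₄ u₁ u₂ u₃ u₄ z w : V}

namespace IsClustering

/-- The vertices of a cubic square need positive weights in every clustering. -/
theorem weight_ne_zero (hr : IsClustering G a d r) (hG : IsSubcubic G)
    (h : IsCubicSquare G v₁ v₂ v₃ v₄ u₁ u₂ u₃ u₄) : a v₁ ≠ 0 ∧ d v₁ ≠ 0 := by
  have hn := h.not_adj hG
  rcases hr.square_cases hG h with h' | h' | h'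
  · refine ⟨hr.add _ _ h.ne₁₃ hn h'.2.1, hr.cut _ _ h.adj₁ fun h1 => ?_⟩
    have := hr.eq_of_square hG h.adj₁₂ h.adj₄₁.symm h.ne₂₄ h.adj₂₃ h.ne₁₃ h'.1 h'.2.2 h'.2.1 h1
    grind [h.adj₁.ne, h.ne₁₂, h.ne₁₄, h.adj₁]
  · exact ⟨hr.add v₁ u₂ h.ne₂₁.symm (hG.triangle_free _ _ _ h.adj₁₂ h.adj₂) h'.2.1.2.2.1,
      hr.cut _ _ h.adj₄₁.symm h'.1⟩
  · exact ⟨hr.add v₁ u₄ h.ne₄₁.symm (hG.triangle_free _ _ _ h.adj₄₁.symm h.adj₄) h'.2.1.2.2.1,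
      hr.cut _ _ h.adj₁₂ h'.1⟩

/-- If the square cannot be cut into opposite edges, it is a class of every clustering, and the
edges leaving it are deleted. -/
theorem not_rel_of_not_adj (hr : IsClustering G a d r) (hG : IsSubcubic G)
    (h : IsCubicSquare G v₁ v₂ v₃ v₄ u₁ u₂ u₃ u₄) (h₁ : ¬ (G.Adj u₁ u₂ ∧ G.Adj u₃ u₄))
    (h₂ : ¬ (G.Adj u₂ u₃ ∧ G.Adj u₄ u₁)) : ¬ r v₁ u₁ := by
  have hn := h.not_adj hG
  intro h1
  rcases hr.square_cases hG h with h' | h' | h'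
  · have := hr.eq_of_square hG h.adj₁₂ h.adj₄₁.symm h.ne₂₄ h.adj₂₃ h.ne₁₃ h'.1 h'.2.2 h'.2.1 h1
    grind [h.adj₁.ne, h.ne₁₂, h.ne₁₄, h.adj₁]
  · exact h₁ ⟨h'.2.1.2.2.2, h'.2.2.2.2.2.symm⟩
  · exact h₂ ⟨h'.2.2.2.2.2, h'.2.1.2.2.2.symm⟩

end IsClustering

/-- The graph `G` with the edges `v₁v₄` and `v₂v₃` of a square deleted, and a path `v₂ z w v₃` added.
The condition `x ≠ y` is only needed to have a simple graph for arbitrary arguments. -/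
def bypass (G : SimpleGraph V) (v₁ v₂ v₃ v₄ z w : V) : SimpleGraph V where
  Adj x y := (G.Adj x y ∧ s(x, y) ≠ s(v₁, v₄) ∧ s(x, y) ≠ s(v₂, v₃)) ∨
    (x ≠ y ∧ (s(x, y) = s(v₂, z) ∨ s(x, y) = s(z, w) ∨ s(x, y) = s(w, v₃)))
  symm := ⟨fun x y h => by
    rwa [Sym2.eq_swap (a := y) (b := x), G.adj_comm y x, ne_comm (a := y) (b := x)]⟩
  loopless := ⟨fun x h => by simp at h⟩

theorem bypass_adj {x y : V} : (bypass G v₁ v₂ v₃ v₄ z w).Adj x y ↔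
    (G.Adj x y ∧ ¬ (x = v₁ ∧ y = v₄) ∧ ¬ (x = v₄ ∧ y = v₁) ∧ ¬ (x = v₂ ∧ y = v₃) ∧
      ¬ (x = v₃ ∧ y = v₂)) ∨
    (x ≠ y ∧ ((x = v₂ ∧ y = z) ∨ (x = z ∧ y = v₂) ∨ (x = z ∧ y = w) ∨ (x = w ∧ y = z) ∨
      (x = w ∧ y = v₃) ∨ (x = v₃ ∧ y = w))) := by
  simp only [bypass, ne_eq, Sym2.eq_iff, not_or, and_assoc, or_assoc]

theorem bypass_reverse : bypass G v₄ v₃ v₂ v₁ w z = bypass G v₁ v₂ v₃ v₄ z w := by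
  ext x y
  simp only [bypass, Sym2.eq_swap (a := v₄), Sym2.eq_swap (a := v₃), Sym2.eq_swap (a := w) (b := z),
    Sym2.eq_swap (a := z) (b := v₂)]
  tauto

theorem bypass_adj_of_ne {x : V} (h1 : x ≠ v₁) (h2 : x ≠ v₂) (h3 : x ≠ v₃) (h4 : x ≠ v₄)
    (hz : x ≠ z) (hw : x ≠ w) (y : V) : (bypass G v₁ v₂ v₃ v₄ z w).Adj x y ↔ G.Adj x y := by
  rw [bypass_adj]
  grind

/-- The situation in which a cubic square is bypassed: the sides `v₁v₂` and `v₃v₄` extend to `4`-cycles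
`v₁ v₂ u₂ u₁` and `v₃ v₄ u₄ u₃`, and the new vertices `z ≠ w` are isolated in `G`. -/
structure IsBypassable (G : SimpleGraph V) (v₁ v₂ v₃ v₄ u₁ u₂ u₃ u₄ z w : V) : Prop extends
    IsCubicSquare G v₁ v₂ v₃ v₄ u₁ u₂ u₃ u₄ where
  subcubic : IsSubcubic G
  adj_u₁₂ : G.Adj u₁ u₂
  adj_u₃₄ : G.Adj u₃ u₄
  not_adj_z : ∀ x, ¬ G.Adj x z
  not_adj_w : ∀ x, ¬ G.Adj x w
  ne_zw : z ≠ w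

namespace IsBypassable

/-- The reflection that exchanges the sides `v₁v₂` and `v₄v₃`; with `bypass_reverse` it transfers
every statement about one side to the other. -/
theorem reverse (h : IsBypassable G v₁ v₂ v₃ v₄ u₁ u₂ u₃ u₄ z w) :
    IsBypassable G v₄ v₃ v₂ v₁ u₄ u₃ u₂ u₁ w z :=
  ⟨h.rotate.rotate.rotate.reflect, h.subcubic, h.adj_u₃₄.symm, h.adj_u₁₂.symm, h.not_adj_w,
    h.not_adj_z, h.ne_zw.symm⟩

theorem adj_v₁ (h : IsBypassable G v₁ v₂ v₃ v₄ u₁ u₂ u₃ u₄ z w) (x : V) :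
    (bypass G v₁ v₂ v₃ v₄ z w).Adj v₁ x ↔ x = v₂ ∨ x = u₁ := by
  rw [bypass_adj, h.adj_iff h.subcubic]
  have := h.not_adj_z v₂
  have := h.not_adj_w v₂
  have := h.adj₁₂
  have := h.adj₂₃
  have := h.adj₄₁
  have := h.adj₁₂.ne
  have := h.adj₄₁.ne
  have := h.ne₁₃
  have := h.ne₁₄
  have := h.ne₂₄
  have := h.not_adj_z v₄
  have := h.not_adj_w v₄
  grind

theorem adj_v₂ (h : IsBypassable G v₁ v₂ v₃ v₄ u₁ u₂ u₃ u₄ z w) (x : V) :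
    (bypass G v₁ v₂ v₃ v₄ z w).Adj v₂ x ↔ x = v₁ ∨ x = u₂ ∨ x = z := by
  rw [bypass_adj, h.rotate.adj_iff h.subcubic]
  have := h.not_adj_z v₁
  have := h.not_adj_w v₁
  have := h.adj₁₂
  have := h.adj₂₃
  have := h.adj₄₁
  have := h.adj₁₂.ne
  have := h.adj₂₃.ne
  have := h.ne₁₃
  have := h.ne₂₃
  have := h.ne₂₄
  have := h.not_adj_z v₂
  have := h.not_adj_w v₂
  have := h.not_adj_z v₃
  have := h.not_adj_w v₃
  grind

theorem adj_z (h : IsBypassable G v₁ v₂ v₃ v₄ u₁ u₂ u₃ u₄ z w) (x : V) :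
    (bypass G v₁ v₂ v₃ v₄ z w).Adj z x ↔ x = v₂ ∨ x = w := by
  rw [bypass_adj]
  have := h.not_adj_z x
  have := G.adj_comm x z
  have := h.adj₂₃
  have := h.not_adj_z v₂
  have := h.not_adj_w v₂
  have := h.not_adj_z v₃
  have := h.not_adj_w v₃
  have := h.ne_zw
  have := h.adj₂₃.symm
  grind

theorem isSubcubic (h : IsBypassable G v₁ v₂ v₃ v₄ u₁ u₂ u₃ u₄ z w) :
    IsSubcubic (bypass G v₁ v₂ v₃ v₄ z w) where
  triangle_free x y t hxy hyt hxt := by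
    have h1 := h.adj_z
    have h2 := h.reverse.adj_z
    have h3 := h.adj_v₂
    have h4 := h.reverse.adj_v₂
    rw [bypass_reverse] at h2 h4
    have hs := fun x y => (bypass G v₁ v₂ v₃ v₄ z w).adj_comm x y
    have ht := h.subcubic.triangle_free x y t
    have := h.ne₁₃
    have := h.ne₂₄
    have := h.ne₂₃
    have := h.ne₃₂
    have := h.adj₁₂.ne
    have := h.adj₂₃.ne
    have := h.adj₃₄.ne
    have := h.ne_zw
    have := hxy.ne
    have := hyt.ne
    have := hxt.ne
    have hnew : ∀ p q, (bypass G v₁ v₂ v₃ v₄ z w).Adj p q → p ≠ z → p ≠ w → q ≠ z → q ≠ w →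
        G.Adj p q := by
      intro p q
      rw [bypass_adj]
      grind
    have hz : ∀ p q, (bypass G v₁ v₂ v₃ v₄ z w).Adj z p → (bypass G v₁ v₂ v₃ v₄ z w).Adj z q →
        ¬ (bypass G v₁ v₂ v₃ v₄ z w).Adj p q := by
      grind [SimpleGraph.irrefl]
    have hw : ∀ p q, (bypass G v₁ v₂ v₃ v₄ z w).Adj w p → (bypass G v₁ v₂ v₃ v₄ z w).Adj w q →
        ¬ (bypass G v₁ v₂ v₃ v₄ z w).Adj p q := by
      grind [SimpleGraph.irrefl]
    rcases eq_or_ne x z with rfl | hxz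
    · exact hz _ _ hxy hxt hyt
    rcases eq_or_ne y z with rfl | hyz
    · exact hz _ _ hxy.symm hyt hxt
    rcases eq_or_ne t z with rfl | htz
    · exact hz _ _ hxt.symm hyt.symm hxy
    rcases eq_or_ne x w with rfl | hxw
    · exact hw _ _ hxy hxt hyt
    rcases eq_or_ne y w with rfl | hyw
    · exact hw _ _ hxy.symm hyt hxt
    rcases eq_or_ne t w with rfl | htw
    · exact hw _ _ hxt.symm hyt.symm hxy
    exact ht (hnew _ _ hxy hxz hxw hyz hyw) (hnew _ _ hyt hyz hyw htz htw)
      (hnew _ _ hxt hxz hxw htz htw)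
  degree_le v := by
    have h1 := h.adj_z
    have h2 := h.reverse.adj_z
    have h3 := h.adj_v₂
    have h4 := h.reverse.adj_v₂
    have h5 := h.adj_v₁
    have h6 := h.reverse.adj_v₁
    rw [bypass_reverse] at h2 h4 h6
    by_cases hz : v = z
    · exact ⟨v₂, w, w, by grind⟩
    by_cases hw : v = w
    · exact ⟨v₃, z, z, by grind⟩
    by_cases h_1 : v = v₁
    · exact ⟨v₂, u₁, u₁, by grind⟩
    by_cases h_2 : v = v₂
    · exact ⟨v₁, u₂, z, by grind⟩
    by_cases h_3 : v = v₃
    · exact ⟨v₄, u₃, w, by grind⟩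
    by_cases h_4 : v = v₄
    · exact ⟨v₃, u₄, u₄, by grind⟩
    obtain ⟨p, q, s, hp⟩ := h.subcubic.degree_le v
    exact ⟨p, q, s, fun x hx => hp x ((bypass_adj_of_ne h_1 h_2 h_3 h_4 hz hw x).1 hx)⟩

end IsBypassable
end ClusterEditing

namespace ClusterEditing

/-! ### Bypassing a square: from the old graph to the new one -/

variable {V : Type*} {G : SimpleGraph V} {a d : V → ℕ} {r : V → V → Prop}
  {v₁ v₂ v₃ v₄ u₁ u₂ u₃ u₄ z w : V}

theorem IsCubicSquare.mono {H : SimpleGraph V} (hle : G ≤ H)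
    (h : IsCubicSquare G v₁ v₂ v₃ v₄ u₁ u₂ u₃ u₄) : IsCubicSquare H v₁ v₂ v₃ v₄ u₁ u₂ u₃ u₄ :=
  { h with
    adj₁₂ := hle h.adj₁₂, adj₂₃ := hle h.adj₂₃, adj₃₄ := hle h.adj₃₄, adj₄₁ := hle h.adj₄₁,
    adj₁ := hle h.adj₁, adj₂ := hle h.adj₂, adj₃ := hle h.adj₃, adj₄ := hle h.adj₄ }

theorem IsSubcubic.anti {H : SimpleGraph V} (hle : G ≤ H) (h : IsSubcubic H) : IsSubcubic G where
  triangle_free x y z hxy hyz hxz := h.triangle_free x y z (hle hxy) (hle hyz) (hle hxz)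
  degree_le v := by
    obtain ⟨p, q, s, hp⟩ := h.degree_le v
    exact ⟨p, q, s, fun x hx => hp x (hle hx)⟩

/-- A criterion for a modified partition: at each vertex either both weights are positive and there are
at most one deleted edge (to `c`) and one missing edge (to `m`), or nothing was made worse at that
vertex. -/
theorem IsClustering.of_local (hr : IsClustering G a d r) {H : SimpleGraph V} {a' d' : V → ℕ}
    {r' : V → V → Prop} (hr' : Equivalence r')
    (h : ∀ x, (a' x ≠ 0 ∧ d' x ≠ 0 ∧ (∃ c, ∀ y, H.Adj x y → r' x y ∨ y = c) ∧
        ∃ m, ∀ y, r' x y → y = x ∨ H.Adj x y ∨ y = m) ∨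
      (a' x = a x ∧ d' x = d x ∧ ∀ y, (H.Adj x y ↔ G.Adj x y) ∧ (r' x y → r x y) ∧
        (G.Adj x y → r x y → r' x y))) :
    IsClustering H a' d' r' where
  equiv := hr'
  cut x y hxy hrxy := by
    have := hr.cut x y
    rcases h x with ⟨ha, hd, ⟨c, hc⟩, m, hm⟩ | ⟨ha, hd, ho⟩ <;> grind
  cut_unique x y y' hxy hrxy hxy' hrxy' := by
    have := hr.cut_unique x y y'
    rcases h x with ⟨ha, hd, ⟨c, hc⟩, m, hm⟩ | ⟨ha, hd, ho⟩ <;> grind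
  add x y hne hxy hrxy := by
    have := hr.add x y
    rcases h x with ⟨ha, hd, ⟨c, hc⟩, m, hm⟩ | ⟨ha, hd, ho⟩ <;> grind
  add_unique x y y' hne hxy hrxy hne' hxy' hrxy' := by
    have := hr.add_unique x y y'
    rcases h x with ⟨ha, hd, ⟨c, hc⟩, m, hm⟩ | ⟨ha, hd, ho⟩ <;> grind

namespace IsBypassable

theorem ne_new (h : IsBypassable G v₁ v₂ v₃ v₄ u₁ u₂ u₃ u₄ z w) {x y : V} (hx : G.Adj x y) :
    x ≠ z ∧ x ≠ w :=
  ⟨fun hz => h.not_adj_z y (hz ▸ hx.symm), fun hw => h.not_adj_w y (hw ▸ hx.symm)⟩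

/-- The vertices `v₁` and `z` have degree `2` after bypassing. -/
theorem corner_ne (h : IsBypassable G v₁ v₂ v₃ v₄ u₁ u₂ u₃ u₄ z w) {x₁ x₂ x₃ x₄ y₁ y₂ y₃ y₄ : V}
    (hs : IsCubicSquare (bypass G v₁ v₂ v₃ v₄ z w) x₁ x₂ x₃ x₄ y₁ y₂ y₃ y₄) :
    x₁ ≠ v₁ ∧ x₁ ≠ z := by
  have h1 := h.adj_v₁
  have h2 := h.adj_z
  have := hs.adj₁₂
  have := hs.adj₄₁.symm
  have := hs.adj₁
  have := hs.ne₂₄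
  have := hs.ne₁₂
  have := hs.ne₁₄
  grind

/-- A `4`-cycle through `v₂` would have to contain `v₁` or `z`. -/
theorem corner_ne' (h : IsBypassable G v₁ v₂ v₃ v₄ u₁ u₂ u₃ u₄ z w) {x₁ x₂ x₃ x₄ y₁ y₂ y₃ y₄ : V}
    (hs : IsCubicSquare (bypass G v₁ v₂ v₃ v₄ z w) x₁ x₂ x₃ x₄ y₁ y₂ y₃ y₄) :
    x₁ ≠ v₁ ∧ x₁ ≠ z ∧ x₁ ≠ v₂ := by
  have h1 := h.adj_v₂
  have := h.corner_ne hs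
  have := h.corner_ne hs.rotate
  have := h.corner_ne hs.rotate.rotate.rotate
  have := hs.adj₁₂
  have := hs.adj₄₁.symm
  have := hs.ne₂₄
  grind

theorem adj_corner (h : IsBypassable G v₁ v₂ v₃ v₄ u₁ u₂ u₃ u₄ z w) {x₁ x₂ x₃ x₄ y₁ y₂ y₃ y₄ : V}
    (hs : IsCubicSquare (bypass G v₁ v₂ v₃ v₄ z w) x₁ x₂ x₃ x₄ y₁ y₂ y₃ y₄) (y : V) :
    (bypass G v₁ v₂ v₃ v₄ z w).Adj x₁ y ↔ G.Adj x₁ y := by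
  obtain ⟨h1, h2, h3⟩ := h.corner_ne' hs
  obtain ⟨h4, h5, h6⟩ := h.reverse.corner_ne' (bypass_reverse ▸ hs)
  exact bypass_adj_of_ne h1 h3 h6 h4 h2 h5 y

/-- Bypassing creates no cubic squares. -/
theorem isCubicSquare (h : IsBypassable G v₁ v₂ v₃ v₄ u₁ u₂ u₃ u₄ z w)
    {x₁ x₂ x₃ x₄ y₁ y₂ y₃ y₄ : V}
    (hs : IsCubicSquare (bypass G v₁ v₂ v₃ v₄ z w) x₁ x₂ x₃ x₄ y₁ y₂ y₃ y₄) :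
    IsCubicSquare G x₁ x₂ x₃ x₄ y₁ y₂ y₃ y₄ :=
  have h1 := h.adj_corner hs
  have h2 := h.adj_corner hs.rotate
  have h3 := h.adj_corner hs.rotate.rotate
  have h4 := h.adj_corner hs.rotate.rotate.rotate
  { hs with
    adj₁₂ := (h1 _).1 hs.adj₁₂, adj₂₃ := (h2 _).1 hs.adj₂₃, adj₃₄ := (h3 _).1 hs.adj₃₄,
    adj₄₁ := (h4 _).1 hs.adj₄₁, adj₁ := (h1 _).1 hs.adj₁, adj₂ := (h2 _).1 hs.adj₂,
    adj₃ := (h3 _).1 hs.adj₃, adj₄ := (h4 _).1 hs.adj₄ }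

/-- If the square is a class of `G`, then it is replaced by the two paths `v₁ v₂ z` and `w v₃ v₄`. -/
theorem isClustering_carve_square (h : IsBypassable G v₁ v₂ v₃ v₄ u₁ u₂ u₃ u₄ z w)
    (hr : IsClustering G a d r) (hz : a z ≠ 0 ∧ d z ≠ 0) (hw : a w ≠ 0 ∧ d w ≠ 0)
    (h2 : r v₁ v₂) (h3 : r v₁ v₃) (h4 : r v₁ v₄) :
    IsClustering (bypass G v₁ v₂ v₃ v₄ z w) a d (carve {v₁, v₂, z} (carve {v₃, v₄, w} r)) := by
  have hc := hr.equiv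
  have hs := h.toIsCubicSquare
  have hw₁ := hr.weight_ne_zero h.subcubic hs
  have hw₂ := hr.weight_ne_zero h.subcubic hs.rotate
  have hw₃ := hr.weight_ne_zero h.subcubic hs.rotate.rotate
  have hw₄ := hr.weight_ne_zero h.subcubic hs.rotate.rotate.rotate
  have hcls : ∀ y, r v₁ y → y = v₁ ∨ y = v₂ ∨ y = v₃ ∨ y = v₄ := fun y =>
    hr.eq_of_square h.subcubic h.adj₁₂ h.adj₄₁.symm h.ne₂₄ h.adj₂₃ h.ne₁₃ h2 h4 h3
  have e1 := h.adj_v₁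
  have e2 := h.adj_v₂
  have e3 := h.reverse.adj_v₂
  have e4 := h.reverse.adj_v₁
  have ez := h.adj_z
  have ew := h.reverse.adj_z
  rw [bypass_reverse] at e3 e4 ew
  have n1 := h.ne_new h.adj₁₂
  have n2 := h.ne_new h.adj₂₃
  have n3 := h.ne_new h.adj₃₄
  have n4 := h.ne_new h.adj₄₁
  have hzw := h.ne_zw
  have h13 := h.ne₁₃
  have h24 := h.ne₂₄
  have h12 := h.adj₁₂.ne
  have h23 := h.adj₂₃.ne
  have h34 := h.adj₃₄.ne
  have h41 := h.adj₄₁.ne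
  refine hr.of_local (carve_equivalence _ (carve_equivalence _ hc)) fun x => ?_
  simp only [carve, Set.mem_insert_iff, Set.mem_singleton_iff]
  by_cases hx1 : x = v₁
  · exact Or.inl ⟨by grind, by grind, ⟨u₁, by grind⟩, z, by grind⟩
  by_cases hx2 : x = v₂
  · exact Or.inl ⟨by grind, by grind, ⟨u₂, by grind⟩, x, by grind⟩
  by_cases hx3 : x = v₃
  · exact Or.inl ⟨by grind, by grind, ⟨u₃, by grind⟩, x, by grind⟩
  by_cases hx4 : x = v₄
  · exact Or.inl ⟨by grind, by grind, ⟨u₄, by grind⟩, w, by grind⟩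
  by_cases hxz : x = z
  · exact Or.inl ⟨by grind, by grind, ⟨w, by grind⟩, v₁, by grind⟩
  by_cases hxw : x = w
  · exact Or.inl ⟨by grind, by grind, ⟨z, by grind⟩, v₄, by grind⟩
  · have eo := bypass_adj_of_ne (G := G) hx1 hx2 hx3 hx4 hxz hxw
    refine Or.inr ⟨trivial, trivial, fun y => ⟨eo y, by grind, fun hxy hrxy => ?_⟩⟩
    have := h.ne_new hxy.symm
    have := hcls x
    have := hc.symm hrxy
    have hn : ∀ v, r v₁ v → ¬ r x v := fun v hv hxv => by
      have := hcls x (hc.trans hv (hc.symm hxv))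
      grind
    have := hn v₁ (hc.refl _)
    grind

/-- If the square is cut into `v₁v₂` and `v₃v₄`, then the new edge `zw` becomes a class. -/
theorem isClustering_carve_sides (h : IsBypassable G v₁ v₂ v₃ v₄ u₁ u₂ u₃ u₄ z w)
    (hr : IsClustering G a d r) (hz : a z ≠ 0 ∧ d z ≠ 0) (hw : a w ≠ 0 ∧ d w ≠ 0)
    (h14 : ¬ r v₁ v₄) :
    IsClustering (bypass G v₁ v₂ v₃ v₄ z w) a d (carve {z, w} r) := by
  have hc := hr.equiv
  have hs := h.toIsCubicSquare
  have hw₁ := hr.weight_ne_zero h.subcubic hs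
  have hw₂ := hr.weight_ne_zero h.subcubic hs.rotate
  have hw₃ := hr.weight_ne_zero h.subcubic hs.rotate.rotate
  have hw₄ := hr.weight_ne_zero h.subcubic hs.rotate.rotate.rotate
  obtain ⟨h12, h1u1, h1u2, hu12⟩ := hr.side_of_not_rel h.subcubic hs h14
  obtain ⟨h43, h4u4, h4u3, hu43⟩ := hr.side_of_not_rel h.subcubic h.reverse.toIsCubicSquare
    fun h' => h14 (hc.symm h')
  have hcls : ∀ y, r v₁ y → y = v₁ ∨ y = v₂ ∨ y = u₂ ∨ y = u₁ := fun y =>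
    hr.eq_of_square h.subcubic h.adj₁₂ h.adj₁ h.ne₁₂.symm h.adj₂ h.ne₂₁.symm h12 h1u1 h1u2
  have hcls' : ∀ y, r v₄ y → y = v₄ ∨ y = v₃ ∨ y = u₃ ∨ y = u₄ := fun y =>
    hr.eq_of_square h.subcubic h.adj₃₄.symm h.adj₄ h.ne₄₃.symm h.adj₃ h.ne₃₄.symm h43 h4u4 h4u3
  have e1 := h.adj_v₁
  have e2 := h.adj_v₂
  have e3 := h.reverse.adj_v₂
  have e4 := h.reverse.adj_v₁
  have ez := h.adj_z
  have ew := h.reverse.adj_z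
  rw [bypass_reverse] at e3 e4 ew
  have n1 := h.ne_new h.adj₁₂
  have n2 := h.ne_new h.adj₂₃
  have n3 := h.ne_new h.adj₃₄
  have n4 := h.ne_new h.adj₄₁
  have m1 := h.ne_new h.adj₁.symm
  have m2 := h.ne_new h.adj₂.symm
  have m3 := h.ne_new h.adj₃.symm
  have m4 := h.ne_new h.adj₄.symm
  have r1 : ∀ y, r v₂ y → r v₁ y := fun y hy => hc.trans h12 hy
  have r2 : ∀ y, r v₁ y → r v₂ y := fun y hy => hc.trans (hc.symm h12) hy
  have r3 : ∀ y, r v₃ y → r v₄ y := fun y hy => hc.trans h43 hy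
  have r4 : ∀ y, r v₄ y → r v₃ y := fun y hy => hc.trans (hc.symm h43) hy
  have rr := hc.refl
  refine hr.of_local (carve_equivalence _ hc) fun x => ?_
  simp only [carve, Set.mem_insert_iff, Set.mem_singleton_iff]
  by_cases hx1 : x = v₁
  · exact Or.inl ⟨by grind, by grind, ⟨x, by grind⟩, u₂, by grind⟩
  by_cases hx2 : x = v₂
  · exact Or.inl ⟨by grind, by grind, ⟨z, by grind⟩, u₁, by grind⟩
  by_cases hx3 : x = v₃
  · exact Or.inl ⟨by grind, by grind, ⟨w, by grind⟩, u₄, by grind⟩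
  by_cases hx4 : x = v₄
  · exact Or.inl ⟨by grind, by grind, ⟨x, by grind⟩, u₃, by grind⟩
  by_cases hxz : x = z
  · exact Or.inl ⟨by grind, by grind, ⟨v₂, by grind⟩, x, by grind⟩
  by_cases hxw : x = w
  · exact Or.inl ⟨by grind, by grind, ⟨v₃, by grind⟩, x, by grind⟩
  · have eo := bypass_adj_of_ne (G := G) hx1 hx2 hx3 hx4 hxz hxw
    refine Or.inr ⟨trivial, trivial, fun y => ⟨eo y, by grind, fun hxy hrxy => ?_⟩⟩
    have := h.ne_new hxy.symm
    grind

end IsBypassable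

/-- If a square can be cut in both directions, it belongs to a cube, and the two ways to split the cube
into opposite faces are interchangeable. -/
theorem IsClustering.flip_cube (hr : IsClustering G a d r) (hG : IsSubcubic G)
    (h : IsCubicSquare G v₁ v₂ v₃ v₄ u₁ u₂ u₃ u₄) (h₁₂ : G.Adj u₁ u₂) (h₃₄ : G.Adj u₃ u₄)
    (hn : ¬ r v₁ v₂) : ∃ r', IsClustering G a d r' ∧ ¬ r' v₁ v₄ := by
  have hc := hr.equiv
  rcases hr.square_cases hG h with h' | h' | ⟨-, ⟨h14, h1u1, h1u4, hu14⟩, h23, h2u2, h2u3, hu23⟩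
  · exact absurd h'.1 hn
  · exact absurd h'.2.1.1 hn
  -- The third neighbours form a cubic square as well, the opposite face of the cube.
  have hu : IsCubicSquare G u₁ u₂ u₃ u₄ v₁ v₂ v₃ v₄ :=
    { adj₁₂ := h₁₂, adj₂₃ := hu23, adj₃₄ := h₃₄, adj₄₁ := hu14.symm
      ne₁₃ := fun e => hn (hc.trans h1u1 (e ▸ hc.symm h2u3))
      ne₂₄ := fun e => hn (hc.trans h1u4 (e ▸ hc.symm h2u2))
      adj₁ := h.adj₁.symm, adj₂ := h.adj₂.symm, adj₃ := h.adj₃.symm, adj₄ := h.adj₄.symm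
      ne₁₂ := h.ne₂₁.symm, ne₁₄ := h.ne₄₁.symm, ne₂₃ := h.ne₃₂.symm, ne₂₁ := h.ne₁₂.symm
      ne₃₄ := h.ne₄₃.symm, ne₃₂ := h.ne₂₃.symm, ne₄₁ := h.ne₁₄.symm, ne₄₃ := h.ne₃₄.symm }
  have hw := hr.weight_ne_zero hG h
  have hw₂ := hr.weight_ne_zero hG h.rotate
  have hw₃ := hr.weight_ne_zero hG h.rotate.rotate
  have hw₄ := hr.weight_ne_zero hG h.rotate.rotate.rotate
  have ha := h.adj_iff hG
  have ha₂ := h.rotate.adj_iff hG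
  have ha₃ := h.rotate.rotate.adj_iff hG
  have ha₄ := h.rotate.rotate.rotate.adj_iff hG
  have kw := hr.weight_ne_zero hG hu
  have kw₂ := hr.weight_ne_zero hG hu.rotate
  have kw₃ := hr.weight_ne_zero hG hu.rotate.rotate
  have kw₄ := hr.weight_ne_zero hG hu.rotate.rotate.rotate
  have ka := hu.adj_iff hG
  have ka₂ := hu.rotate.adj_iff hG
  have ka₃ := hu.rotate.rotate.adj_iff hG
  have ka₄ := hu.rotate.rotate.rotate.adj_iff hG
  have h13 := h.ne₁₃
  have h24 := h.ne₂₄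
  have k13 := hu.ne₁₃
  have k24 := hu.ne₂₄
  have n1 : u₁ ≠ v₁ ∧ u₁ ≠ v₂ ∧ u₁ ≠ v₃ ∧ u₁ ≠ v₄ :=
    ⟨h.adj₁.ne', h.ne₁₂, fun e => h.not_adj hG (e ▸ h.adj₁), h.ne₁₄⟩
  have n2 : u₂ ≠ v₁ ∧ u₂ ≠ v₂ ∧ u₂ ≠ v₃ ∧ u₂ ≠ v₄ :=
    ⟨h.ne₂₁, h.adj₂.ne', h.ne₂₃, fun e => h.rotate.not_adj hG (e ▸ h.adj₂)⟩
  have n3 : u₃ ≠ v₁ ∧ u₃ ≠ v₂ ∧ u₃ ≠ v₃ ∧ u₃ ≠ v₄ :=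
    ⟨fun e => h.not_adj hG (e ▸ h.adj₃.symm), h.ne₃₂, h.adj₃.ne', h.ne₃₄⟩
  have n4 : u₄ ≠ v₁ ∧ u₄ ≠ v₂ ∧ u₄ ≠ v₃ ∧ u₄ ≠ v₄ :=
    ⟨h.ne₄₁, fun e => h.rotate.not_adj hG (e ▸ h.adj₄.symm), h.ne₄₃, h.adj₄.ne'⟩
  have nv : v₁ ≠ v₂ ∧ v₂ ≠ v₃ ∧ v₃ ≠ v₄ ∧ v₄ ≠ v₁ :=
    ⟨h.adj₁₂.ne, h.adj₂₃.ne, h.adj₃₄.ne, h.adj₄₁.ne⟩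
  have nu : u₁ ≠ u₂ ∧ u₂ ≠ u₃ ∧ u₃ ≠ u₄ ∧ u₄ ≠ u₁ :=
    ⟨hu.adj₁₂.ne, hu.adj₂₃.ne, hu.adj₃₄.ne, hu.adj₄₁.ne⟩
  refine ⟨carve {v₁, v₂, u₂, u₁} (carve {v₄, v₃, u₃, u₄} r), hr.of_local
    (carve_equivalence _ (carve_equivalence _ hc)) fun x => ?_, ?_⟩
  · simp only [carve, Set.mem_insert_iff, Set.mem_singleton_iff]
    by_cases hx1 : x = v₁
    · exact Or.inl ⟨by grind, by grind, ⟨v₄, by grind⟩, u₂, by grind⟩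
    by_cases hx2 : x = v₂
    · exact Or.inl ⟨by grind, by grind, ⟨v₃, by grind⟩, u₁, by grind⟩
    by_cases hx3 : x = v₃
    · exact Or.inl ⟨by grind, by grind, ⟨v₂, by grind⟩, u₄, by grind⟩
    by_cases hx4 : x = v₄
    · exact Or.inl ⟨by grind, by grind, ⟨v₁, by grind⟩, u₃, by grind⟩
    by_cases hy1 : x = u₁
    · exact Or.inl ⟨by grind, by grind, ⟨u₄, by grind⟩, v₂, by grind⟩
    by_cases hy2 : x = u₂
    · exact Or.inl ⟨by grind, by grind, ⟨u₃, by grind⟩, v₁, by grind⟩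
    by_cases hy3 : x = u₃
    · exact Or.inl ⟨by grind, by grind, ⟨u₂, by grind⟩, v₄, by grind⟩
    by_cases hy4 : x = u₄
    · exact Or.inl ⟨by grind, by grind, ⟨u₁, by grind⟩, v₃, by grind⟩
    · refine Or.inr ⟨trivial, trivial, fun y => ⟨trivial, by grind, fun hxy hrxy => ?_⟩⟩
      have := hxy.symm
      grind
  · simp only [carve, Set.mem_insert_iff, Set.mem_singleton_iff]
    grind

end ClusterEditing

namespace ClusterEditing

/-! ### Bypassing a square: from the new graph to the old one -/

variable {V : Type*} {G : SimpleGraph V} {a d : V → ℕ} {r : V → V → Prop}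
  {v₁ v₂ v₃ v₄ u₁ u₂ u₃ u₄ z w : V}

namespace IsBypassable

/-- The vertex `z` does not keep both of its edges. -/
theorem not_rel_of_rel (h : IsBypassable G v₁ v₂ v₃ v₄ u₁ u₂ u₃ u₄ z w)
    (hr : IsClustering (bypass G v₁ v₂ v₃ v₄ z w) a d r) (h2 : r v₂ z) : ¬ r z w := by
  intro hzw
  have hc := hr.equiv
  have ez := h.adj_z
  have ew := h.reverse.adj_z
  rw [bypass_reverse] at ew
  have n2 := h.ne_new h.adj₂₃
  have key : ∀ y, r v₂ y → y ≠ v₂ → y ≠ w → (bypass G v₁ v₂ v₃ v₄ z w).Adj w y :=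
    fun y hy hy2 hyw => hr.adj_of_path h.isSubcubic (v := z) (q := v₂) (by grind) (by grind) n2.2.symm
      hzw (hc.symm h2) (hc.trans (hc.symm h2) hy) hyw hy2
  have n1 := h.ne_new h.adj₁₂
  have m2 := h.ne_new h.adj₂.symm
  have h13 := h.ne₁₃
  have h23 := h.ne₂₃
  rcases hr.rel_or ((h.adj_v₂ v₁).2 (by simp)) ((h.adj_v₂ u₂).2 (by simp)) h.ne₂₁.symm with h5 | h5
  · have := key _ h5 h.adj₁₂.ne n1.2
    grind
  · have := key _ h5 h.adj₂.ne' m2.2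
    grind

theorem adj_u₁ (h : IsBypassable G v₁ v₂ v₃ v₄ u₁ u₂ u₃ u₄ z w) (y : V) :
    (bypass G v₁ v₂ v₃ v₄ z w).Adj u₁ y ↔ G.Adj u₁ y :=
  bypass_adj_of_ne h.adj₁.ne' h.ne₁₂
    (fun e => h.not_adj h.subcubic (by simpa [e] using h.adj₁))
    h.ne₁₄
    (h.ne_new h.adj₁.symm).1 (h.ne_new h.adj₁.symm).2 y

/-- If `v₂z` is deleted, then `v₁ v₂ u₂ u₁` lies in one class, and `v₃w` is deleted as well. -/
theorem rel_of_not_rel (h : IsBypassable G v₁ v₂ v₃ v₄ u₁ u₂ u₃ u₄ z w)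
    (hr : IsClustering (bypass G v₁ v₂ v₃ v₄ z w) a d r) (h2 : ¬ r v₂ z) :
    r v₁ v₂ ∧ r v₁ u₁ ∧ r v₁ u₂ ∧ ¬ r v₃ w := by
  have hc := hr.equiv
  have e1 := h.adj_v₁
  have e2 := h.adj_v₂
  have ez := h.adj_z
  have n1 := h.ne_new h.adj₁₂
  have m2 := h.ne_new h.adj₂.symm
  have h12 : r v₁ v₂ := hc.symm
    ((hr.rel_or ((e2 v₁).2 (by simp)) ((e2 z).2 (by simp)) n1.1).resolve_right h2)
  have h22 : r v₂ u₂ :=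
    (hr.rel_or ((e2 u₂).2 (by simp)) ((e2 z).2 (by simp)) m2.1).resolve_right h2
  refine ⟨h12, ?_, hc.trans h12 h22, fun h3 => ?_⟩
  · by_contra hn
    have := hr.cut_unique u₁ v₁ u₂ ((e1 u₁).2 (by simp)).symm (fun h' => hn (hc.symm h'))
      ((h.adj_u₁ _).2 h.adj_u₁₂) fun h' => hn (hc.trans h12 (hc.trans h22 (hc.symm h')))
    exact h.ne₂₁ this.symm
  · have hwz := h.reverse.not_rel_of_rel (bypass_reverse ▸ hr) h3
    have n2 := h.ne_new h.adj₂₃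
    exact n2.2 (hr.cut_unique z v₂ w ((ez v₂).2 (by simp)) (fun h' => h2 (hc.symm h'))
      ((ez w).2 (by simp)) fun h' => hwz (hc.symm h'))

/-- If `v₂z` is kept, then `z v₂ v₁` may be assumed to lie in one class.  Otherwise `{z, v₂, u₂}` is a
class, and `u₂` has used up its deletion on `u₁`; so `v₂` and `u₁` are the only neighbours of `u₂`.
These are also the neighbours of `v₁`, and `v₁` can be exchanged with `u₂`. -/
theorem exists_rel_of_rel (h : IsBypassable G v₁ v₂ v₃ v₄ u₁ u₂ u₃ u₄ z w)
    (hr : IsClustering (bypass G v₁ v₂ v₃ v₄ z w) a d r) (hw₁ : a v₁ ≠ 0 ∧ d v₁ ≠ 0)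
    (h2 : r v₂ z) : ∃ r', IsClustering (bypass G v₁ v₂ v₃ v₄ z w) a d r' ∧
      r' v₂ z ∧ r' v₂ v₁ ∧ (r v₃ w → r' v₃ w) ∧ (r v₃ v₄ → r' v₃ v₄) := by
  classical
  have hc := hr.equiv
  by_cases h21 : r v₂ v₁
  · exact ⟨r, hr, h2, h21, id, id⟩
  have e1 := h.adj_v₁
  have e2 := h.adj_v₂
  have ez := h.adj_z
  have ew := h.reverse.adj_z
  rw [bypass_reverse] at ew
  have eu := h.adj_u₁
  have n1 := h.ne_new h.adj₁₂
  have n2 := h.ne_new h.adj₂₃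
  have m1 := h.ne_new h.adj₁.symm
  have m2 := h.ne_new h.adj₂.symm
  have hs := h.isSubcubic
  have h22 : r v₂ u₂ :=
    (hr.rel_or ((e2 u₂).2 (by simp)) ((e2 v₁).2 (by simp)) h.ne₂₁).resolve_right h21
  have hu := h.adj_u₁₂
  have es := (bypass G v₁ v₂ v₃ v₄ z w).adj_comm
  have h23 := h.ne₂₃
  have k12 := h.ne₁₂
  have hcls : ∀ y, r v₂ y → y = v₂ ∨ y = u₂ ∨ y = z := by
    intro y hy
    by_contra! hn
    have h5 := hr.adj_of_path hs ((e2 z).2 (by simp)) ((e2 u₂).2 (by simp)) m2.1.symm h2 h22 hy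
      hn.2.2 hn.2.1
    have h6 := hr.adj_of_path hs ((e2 u₂).2 (by simp)) ((e2 z).2 (by simp)) m2.1 h22 h2 hy
      hn.2.1 hn.2.2
    grind
  have hcut : ¬ r u₂ u₁ := fun h' => by
    have := hcls _ (hc.trans h22 h')
    grind [hu.ne]
  have hu2 : ∀ x, (bypass G v₁ v₂ v₃ v₄ z w).Adj u₂ x ↔ x = v₂ ∨ x = u₁ := by
    refine fun x => ⟨fun hx => ?_, ?_⟩
    · by_cases hrx : r u₂ x
      · have := hcls _ (hc.trans h22 hrx)
        grind [hx.ne, h.adj₂.ne]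
      · exact Or.inr (hr.cut_unique _ _ _ hx hrx ((eu _).2 hu).symm hcut)
    · rintro (rfl | rfl)
      · exact ((e2 u₂).2 (by simp)).symm
      · exact ((eu _).2 hu).symm
  have had : ¬ (bypass G v₁ v₂ v₃ v₄ z w).Adj u₂ z := by grind
  have hau := hr.add _ _ m2.1 had (hc.trans (hc.symm h22) h2)
  have hdu := hr.cut _ _ ((eu _).2 hu).symm hcut
  have h24 : u₂ ≠ v₄ := fun e => h.rotate.not_adj h.subcubic (e ▸ h.adj₂)
  have h21' := h.ne₂₁
  have nv : v₁ ≠ v₂ ∧ v₃ ≠ v₁ ∧ v₄ ≠ v₁ := ⟨h.adj₁₂.ne, h.ne₁₃.symm, h.adj₄₁.ne⟩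
  refine ⟨_, hr.comap (Equiv.swap v₁ u₂) ?_ ?_ ?_, ?_⟩
  · exact adj_swap_iff fun t => by rw [e1, hu2]
  · intro x
    simp only [Equiv.swap_apply_def]
    grind
  · intro x
    simp only [Equiv.swap_apply_def]
    grind
  · have s1 : Equiv.swap v₁ u₂ v₂ = v₂ := Equiv.swap_apply_of_ne_of_ne nv.1.symm h.adj₂.ne
    have s2 : Equiv.swap v₁ u₂ z = z := Equiv.swap_apply_of_ne_of_ne n1.1.symm m2.1.symm
    have s3 : Equiv.swap v₁ u₂ v₃ = v₃ := Equiv.swap_apply_of_ne_of_ne nv.2.1 h23.symm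
    have s4 : Equiv.swap v₁ u₂ w = w := Equiv.swap_apply_of_ne_of_ne n1.2.symm m2.2.symm
    have s5 : Equiv.swap v₁ u₂ v₄ = v₄ := Equiv.swap_apply_of_ne_of_ne nv.2.2 h24.symm
    simp only [s1, s2, s3, s4, s5, Equiv.swap_apply_left]
    exact ⟨h2, h22, id, id⟩

/-- If `z v₂ v₁` lies in one class, it is the whole class. -/
theorem eq_of_rel (h : IsBypassable G v₁ v₂ v₃ v₄ u₁ u₂ u₃ u₄ z w)
    (hr : IsClustering (bypass G v₁ v₂ v₃ v₄ z w) a d r) (h2 : r v₂ z) (h21 : r v₂ v₁) {y : V}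
    (hy : r v₂ y) : y = v₂ ∨ y = v₁ ∨ y = z := by
  by_contra! hn
  have e1 := h.adj_v₁
  have e2 := h.adj_v₂
  have ez := h.adj_z
  have n1 := h.ne_new h.adj₁₂
  have m1 := h.ne_new h.adj₁.symm
  have h5 := hr.adj_of_path h.isSubcubic ((e2 z).2 (by simp)) ((e2 v₁).2 (by simp)) n1.1.symm h2
    h21 hy hn.2.2 hn.2.1
  have h6 := hr.adj_of_path h.isSubcubic ((e2 v₁).2 (by simp)) ((e2 z).2 (by simp)) n1.1 h21 h2 hy
    hn.2.1 hn.2.2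
  grind

theorem clusterable_of_bypass (h : IsBypassable G v₁ v₂ v₃ v₄ u₁ u₂ u₃ u₄ z w)
    (hz : a z ≠ 0 ∧ d z ≠ 0) (hw : a w ≠ 0 ∧ d w ≠ 0)
    (hw₁ : a v₁ ≠ 0 ∧ d v₁ ≠ 0) (hw₂ : a v₂ ≠ 0 ∧ d v₂ ≠ 0) (hw₃ : a v₃ ≠ 0 ∧ d v₃ ≠ 0)
    (hw₄ : a v₄ ≠ 0 ∧ d v₄ ≠ 0) (hH : Clusterable (bypass G v₁ v₂ v₃ v₄ z w) a d) :
    Clusterable G a d := by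
  obtain ⟨r, hr⟩ := hH
  have e1 := h.adj_v₁
  have e2 := h.adj_v₂
  have e3 := h.reverse.adj_v₂
  have e4 := h.reverse.adj_v₁
  have ez := h.adj_z
  have ew := h.reverse.adj_z
  rw [bypass_reverse] at e3 e4 ew
  have g1 := h.adj_iff h.subcubic
  have g2 := h.rotate.adj_iff h.subcubic
  have g3 := h.rotate.rotate.adj_iff h.subcubic
  have g4 := h.rotate.rotate.rotate.adj_iff h.subcubic
  have gz : ∀ x, ¬ G.Adj z x := fun x hx => h.not_adj_z x hx.symm
  have gw : ∀ x, ¬ G.Adj w x := fun x hx => h.not_adj_w x hx.symm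
  have n1 := h.ne_new h.adj₁₂
  have n2 := h.ne_new h.adj₂₃
  have n3 := h.ne_new h.adj₃₄
  have n4 := h.ne_new h.adj₄₁
  have hs := h.isSubcubic
  by_cases h2 : r v₂ z
  · have h3 : r v₃ w := by
      by_contra h3
      exact (h.reverse.rel_of_not_rel (bypass_reverse ▸ hr) h3).2.2.2 h2
    obtain ⟨r, hr, h2, h21, h3, -⟩ : ∃ r, IsClustering (bypass G v₁ v₂ v₃ v₄ z w) a d r ∧
        r v₂ z ∧ r v₂ v₁ ∧ r v₃ w ∧ True := by
      obtain ⟨r', hr', a1, a2, a3, a4⟩ := h.exists_rel_of_rel hr hw₁ h2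
      exact ⟨r', hr', a1, a2, a3 h3, trivial⟩
    obtain ⟨r, hr, h3, h34, h2, h21⟩ : ∃ r, IsClustering (bypass G v₁ v₂ v₃ v₄ z w) a d r ∧
        r v₃ w ∧ r v₃ v₄ ∧ r v₂ z ∧ r v₂ v₁ := by
      obtain ⟨r', hr', a1, a2, a3, a4⟩ :=
        h.reverse.exists_rel_of_rel (bypass_reverse ▸ hr) hw₄ h3
      exact ⟨r', bypass_reverse ▸ hr', a1, a2, a3 h2, a4 h21⟩
    have hc := hr.equiv
    have hcls : ∀ y, r v₂ y → y = v₂ ∨ y = v₁ ∨ y = z := fun _ => h.eq_of_rel hr h2 h21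
    have hcls' : ∀ y, r v₃ y → y = v₃ ∨ y = v₄ ∨ y = w :=
      fun _ => h.reverse.eq_of_rel (bypass_reverse ▸ hr) h3 h34
    refine ⟨carve {v₁, v₂, v₃, v₄} r, hr.of_local (carve_equivalence _ hc) fun x => ?_⟩
    simp only [carve, Set.mem_insert_iff, Set.mem_singleton_iff]
    by_cases hx1 : x = v₁
    · exact Or.inl ⟨by grind, by grind, ⟨u₁, by grind⟩, v₃, by grind⟩
    by_cases hx2 : x = v₂
    · exact Or.inl ⟨by grind, by grind, ⟨u₂, by grind⟩, v₄, by grind⟩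
    by_cases hx3 : x = v₃
    · exact Or.inl ⟨by grind, by grind, ⟨u₃, by grind⟩, v₁, by grind⟩
    by_cases hx4 : x = v₄
    · exact Or.inl ⟨by grind, by grind, ⟨u₄, by grind⟩, v₂, by grind⟩
    by_cases hxz : x = z
    · refine Or.inl ⟨by grind, by grind, ⟨w, by grind⟩, z, fun y hy => ?_⟩
      have := hcls y (by subst hxz; exact hc.trans h2 (by tauto))
      grind
    by_cases hxw : x = w
    · refine Or.inl ⟨by grind, by grind, ⟨w, by grind⟩, w, fun y hy => ?_⟩
      have := hcls' y (by subst hxw; exact hc.trans h3 (by tauto))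
      grind
    · have eo := bypass_adj_of_ne (G := G) hx1 hx2 hx3 hx4 hxz hxw
      refine Or.inr ⟨trivial, trivial, fun y => ⟨(eo y).symm, by grind, fun hxy hrxy => ?_⟩⟩
      have q1 := hcls x
      have q2 := hcls' x
      have q3 : r v₂ y → r v₂ x := fun h' => hc.trans h' (hc.symm hrxy)
      have q4 : r v₃ y → r v₃ x := fun h' => hc.trans h' (hc.symm hrxy)
      have q5 := hc.refl
      grind
  · obtain ⟨h12, h1u1, h1u2, h3⟩ := h.rel_of_not_rel hr h2
    obtain ⟨h43, h4u4, h4u3, -⟩ := h.reverse.rel_of_not_rel (bypass_reverse ▸ hr) h3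
    have hc := hr.equiv
    have b1 := h.adj_u₁
    have b4 := h.reverse.adj_u₁
    have hcls : ∀ y, r v₁ y → y = v₁ ∨ y = v₂ ∨ y = u₂ ∨ y = u₁ := fun y =>
      hr.eq_of_square hs ((e1 v₂).2 (by simp)) ((e1 u₁).2 (by simp)) h.ne₁₂.symm
        ((e2 u₂).2 (by simp)) h.ne₂₁.symm h12 h1u1 h1u2
    have hcls' : ∀ y, r v₄ y → y = v₄ ∨ y = v₃ ∨ y = u₃ ∨ y = u₄ := fun y =>
      hr.eq_of_square hs ((e4 v₃).2 (by simp)) ((e4 u₄).2 (by simp)) h.ne₄₃.symm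
        ((e3 u₃).2 (by simp)) h.ne₃₄.symm h43 h4u4 h4u3
    have m1 := h.ne_new h.adj₁.symm
    have m2 := h.ne_new h.adj₂.symm
    have m3 := h.ne_new h.adj₃.symm
    have m4 := h.ne_new h.adj₄.symm
    have r1 : ∀ y, r v₂ y → r v₁ y := fun y hy => hc.trans h12 hy
    have r2 : ∀ y, r v₁ y → r v₂ y := fun y hy => hc.trans (hc.symm h12) hy
    have r3 : ∀ y, r v₃ y → r v₄ y := fun y hy => hc.trans h43 hy
    have r4 : ∀ y, r v₄ y → r v₃ y := fun y hy => hc.trans (hc.symm h43) hy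
    have rr := hc.refl
    refine ⟨carve {z} (carve {w} r),
      hr.of_local (carve_equivalence _ (carve_equivalence _ hc)) fun x => ?_⟩
    simp only [carve, Set.mem_singleton_iff]
    by_cases hx1 : x = v₁
    · exact Or.inl ⟨by grind, by grind, ⟨v₄, by grind⟩, u₂, by grind⟩
    by_cases hx2 : x = v₂
    · exact Or.inl ⟨by grind, by grind, ⟨v₃, by grind⟩, u₁, by grind⟩
    by_cases hx3 : x = v₃
    · exact Or.inl ⟨by grind, by grind, ⟨v₂, by grind⟩, u₄, by grind⟩
    by_cases hx4 : x = v₄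
    · exact Or.inl ⟨by grind, by grind, ⟨v₁, by grind⟩, u₃, by grind⟩
    by_cases hxz : x = z
    · exact Or.inl ⟨by grind, by grind, ⟨x, by grind⟩, x, by grind⟩
    by_cases hxw : x = w
    · exact Or.inl ⟨by grind, by grind, ⟨x, by grind⟩, x, by grind⟩
    · have eo := bypass_adj_of_ne (G := G) hx1 hx2 hx3 hx4 hxz hxw
      refine Or.inr ⟨trivial, trivial, fun y => ⟨(eo y).symm, by grind, fun hxy hrxy => ?_⟩⟩
      have := h.ne_new ((eo y).1 hxy).symm
      grind

/-- Bypassing a square preserves the answer.  The edges `v₂z` and `v₃w` are kept or deleted together: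
if kept, the square is a class of `G`; if deleted, the square is cut into `v₁v₂` and `v₃v₄`. -/
theorem clusterable_bypass_iff (h : IsBypassable G v₁ v₂ v₃ v₄ u₁ u₂ u₃ u₄ z w)
    (hz : a z ≠ 0 ∧ d z ≠ 0) (hw : a w ≠ 0 ∧ d w ≠ 0)
    (hw₁ : a v₁ ≠ 0 ∧ d v₁ ≠ 0) (hw₂ : a v₂ ≠ 0 ∧ d v₂ ≠ 0) (hw₃ : a v₃ ≠ 0 ∧ d v₃ ≠ 0)
    (hw₄ : a v₄ ≠ 0 ∧ d v₄ ≠ 0) :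
    Clusterable (bypass G v₁ v₂ v₃ v₄ z w) a d ↔ Clusterable G a d := by
  refine ⟨h.clusterable_of_bypass hz hw hw₁ hw₂ hw₃ hw₄, fun ⟨r, hr⟩ => ?_⟩
  wlog h14 : ¬ r v₁ v₄ ∨ r v₁ v₂ generalizing r
  · push Not at h14
    obtain ⟨r', hr', h'⟩ := hr.flip_cube h.subcubic h.toIsCubicSquare h.adj_u₁₂ h.adj_u₃₄ h14.2
    exact this r' hr' (Or.inl h')
  by_cases h4 : r v₁ v₄
  · have h2 := h14.resolve_left (not_not.2 h4)
    exact ⟨_, h.isClustering_carve_square hr hz hw h2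
      (hr.square_of_rel h.subcubic h.toIsCubicSquare h2 h4) h4⟩
  · exact ⟨_, h.isClustering_carve_sides hr hz hw h4⟩

end IsBypassable

/-- The weights of isolated vertices are irrelevant, as an isolated vertex can be made a class of its
own. -/
theorem Clusterable.of_eq_of_adj {a' d' : V → ℕ} (hG : Clusterable G a d)
    (h : ∀ x y, G.Adj x y → a' x = a x ∧ d' x = d x) : Clusterable G a' d' := by
  obtain ⟨r, hr⟩ := hG
  have hc := hr.equiv
  refine ⟨fun x y => x = y ∨ ((∃ t, G.Adj x t) ∧ (∃ t, G.Adj y t) ∧ r x y),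
    ⟨fun x => Or.inl rfl, ?_, ?_⟩, ?_, ?_, ?_, ?_⟩
  · rintro x y (rfl | ⟨hx, hy, hxy⟩)
    exacts [Or.inl rfl, Or.inr ⟨hy, hx, hc.symm hxy⟩]
  · rintro x y z (rfl | ⟨hx, hy, hxy⟩) (rfl | ⟨hy', hz, hyz⟩)
    exacts [Or.inl rfl, Or.inr ⟨hy', hz, hyz⟩, Or.inr ⟨hx, hy, hxy⟩,
      Or.inr ⟨hx, hz, hc.trans hxy hyz⟩]
  · intro x y hxy hn
    rw [(h x y hxy).2]
    exact hr.cut x y hxy fun hrxy => hn (Or.inr ⟨⟨y, hxy⟩, ⟨x, hxy.symm⟩, hrxy⟩)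
  · intro x y y' hxy hn hxy' hn'
    exact hr.cut_unique x y y' hxy (fun hrxy => hn (Or.inr ⟨⟨y, hxy⟩, ⟨x, hxy.symm⟩, hrxy⟩)) hxy'
      fun hrxy => hn' (Or.inr ⟨⟨y', hxy'⟩, ⟨x, hxy'.symm⟩, hrxy⟩)
  · rintro x y hne hxy (rfl | ⟨⟨t, ht⟩, -, hrxy⟩)
    · exact absurd rfl hne
    · rw [(h x t ht).1]
      exact hr.add x y hne hxy hrxy
  · rintro x y y' hne hxy (rfl | ⟨-, -, hrxy⟩) hne' hxy' (rfl | ⟨-, -, hrxy'⟩)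
    · exact absurd rfl hne
    · exact absurd rfl hne
    · exact absurd rfl hne'
    · exact hr.add_unique x y y' hne hxy hrxy hne' hxy' hrxy'

end ClusterEditing

namespace ClusterEditing

/-! ### Instances as graphs on the natural numbers -/

theorem IsClusterGraph.adj_trans {V : Type*} {C : SimpleGraph V} (hC : IsClusterGraph C) {x y z : V}
    (hxy : C.Adj x y) (hyz : C.Adj y z) (hxz : x ≠ z) : C.Adj x z :=
  hC (C.connectedComponentMk x) rfl
    (SimpleGraph.ConnectedComponent.sound (hxy.reachable.trans hyz.reachable).symm) hxz

theorem isClusterGraph_of_equivalence {V : Type*} {C : SimpleGraph V} {r : V → V → Prop}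
    (hr : Equivalence r) (hC : ∀ x y, C.Adj x y ↔ x ≠ y ∧ r x y) : IsClusterGraph C := by
  intro c x hx y hy hxy
  have hreach : C.Reachable x y := SimpleGraph.ConnectedComponent.exact (hx.trans hy.symm)
  obtain ⟨p⟩ := hreach
  refine (hC x y).2 ⟨hxy, ?_⟩
  clear hx hy hxy
  induction p with
  | nil => exact hr.refl _
  | cons h _ ih => exact hr.trans ((hC _ _).1 h).2 ih

theorem subsingleton_of_ncard_le {α : Type*} [Finite α] {s : Set α} {k : Fin 2}
    (h : s.ncard ≤ k) : s.Subsingleton :=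
  fun x hx y hy => (Set.ncard_le_one (Set.toFinite s)).1 (by omega) x hx y hy

theorem ne_zero_of_ncard_le {α : Type*} [Finite α] {s : Set α} {k : ℕ}
    (h : s.ncard ≤ k) {x : α} (hx : x ∈ s) : k ≠ 0 := by
  have := (Set.ncard_pos (Set.toFinite s)).2 ⟨x, hx⟩
  omega

theorem ncard_le_of_subsingleton {α : Type*} [Finite α] {s : Set α} {k : ℕ}
    (h : s.Subsingleton) (hk : ∀ x ∈ s, k ≠ 0) : s.ncard ≤ k := by
  rcases s.eq_empty_or_nonempty with rfl | ⟨x, hx⟩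
  · simp
  · have := (Set.ncard_le_one (Set.toFinite s)).2 fun x hx y hy => h hx hy
    have := hk x hx
    omega

/-- An instance may be replaced by a graph on `ℕ` whose edges lie below the order: the further vertices
are isolated. -/
theorem Instance.isYes_iff (J : Instance 1 1) {G : SimpleGraph ℕ} {a d : ℕ → ℕ}
    (hG : ∀ i j : Fin J.order, G.Adj i j ↔ J.graph.Adj i j)
    (hlt : ∀ i j, G.Adj i j → i < J.order)
    (ha : ∀ i : Fin J.order, a i = J.add i) (hd : ∀ i : Fin J.order, d i = J.del i) :
    J.IsYes ↔ Clusterable G a d := by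
  constructor
  · rintro ⟨D, A, -, hA, hdel, hadd, hC⟩
    set C := (J.graph \ D) ⊔ A
    have hCadj : ∀ x y, C.Adj x y ↔ (J.graph.Adj x y ∧ ¬ D.Adj x y) ∨ A.Adj x y := fun _ _ => Iff.rfl
    refine ⟨fun x y => x = y ∨ ∃ (hx : x < J.order) (hy : y < J.order), C.Adj ⟨x, hx⟩ ⟨y, hy⟩,
      ⟨fun _ => Or.inl rfl, ?_, ?_⟩, ?_, ?_, ?_, ?_⟩
    · rintro x y (rfl | ⟨hx, hy, h⟩)
      exacts [Or.inl rfl, Or.inr ⟨hy, hx, h.symm⟩]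
    · rintro x y z (rfl | ⟨hx, hy, hxy⟩) (rfl | ⟨hy', hz, hyz⟩)
      · exact Or.inl rfl
      · exact Or.inr ⟨hy', hz, hyz⟩
      · exact Or.inr ⟨hx, hy, hxy⟩
      · by_cases hxz : x = z
        · exact Or.inl hxz
        · exact Or.inr ⟨hx, hz, hC.adj_trans hxy hyz (by simpa using hxz)⟩
    · intro x y hxy hn
      have hx := hlt x y hxy
      have hy := hlt y x hxy.symm
      have h1 := (hG ⟨x, hx⟩ ⟨y, hy⟩).1 hxy
      have h2 : D.Adj ⟨x, hx⟩ ⟨y, hy⟩ := by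
        by_contra h2
        exact hn (Or.inr ⟨hx, hy, (hCadj _ _).2 (Or.inl ⟨h1, h2⟩)⟩)
      have := ne_zero_of_ncard_le (hdel ⟨x, hx⟩) h2
      rwa [← hd] at this
    · intro x y y' hxy hn hxy' hn'
      have hx := hlt x y hxy
      have key : ∀ y, G.Adj x y → ¬ (x = y ∨ ∃ (hx : x < J.order) (hy : y < J.order),
          C.Adj ⟨x, hx⟩ ⟨y, hy⟩) → ∃ hy : y < J.order, D.Adj ⟨x, hx⟩ ⟨y, hy⟩ := by
        intro y hxy hn
        have hy := hlt y x hxy.symm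
        refine ⟨hy, ?_⟩
        by_contra h2
        exact hn (Or.inr ⟨hx, hy, (hCadj _ _).2 (Or.inl ⟨(hG ⟨x, hx⟩ ⟨y, hy⟩).1 hxy, h2⟩)⟩)
      obtain ⟨hy, h1⟩ := key y hxy hn
      obtain ⟨hy', h2⟩ := key y' hxy' hn'
      simpa using subsingleton_of_ncard_le (hdel ⟨x, hx⟩) h1 h2
    · rintro x y hne hxy (rfl | ⟨hx, hy, h⟩)
      · exact absurd rfl hne
      · have h1 : A.Adj ⟨x, hx⟩ ⟨y, hy⟩ :=
          ((hCadj _ _).1 h).resolve_left fun h' => hxy ((hG ⟨x, hx⟩ ⟨y, hy⟩).2 h'.1)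
        have := ne_zero_of_ncard_le (hadd ⟨x, hx⟩) h1
        rwa [← ha] at this
    · rintro x y y' hne hxy (rfl | ⟨hx, hy, h⟩) hne' hxy' (rfl | ⟨hx', hy', h'⟩)
      · exact absurd rfl hne
      · exact absurd rfl hne
      · exact absurd rfl hne'
      · have h1 : A.Adj ⟨x, hx⟩ ⟨y, hy⟩ :=
          ((hCadj _ _).1 h).resolve_left fun h' => hxy ((hG ⟨x, hx⟩ ⟨y, hy⟩).2 h'.1)
        have h2 : A.Adj ⟨x, hx⟩ ⟨y', hy'⟩ :=
          ((hCadj _ _).1 h').resolve_left fun h' => hxy' ((hG ⟨x, hx⟩ ⟨y', hy'⟩).2 h'.1)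
        simpa using subsingleton_of_ncard_le (hadd ⟨x, hx⟩) h1 h2
  · rintro ⟨r, hr⟩
    have hc := hr.equiv
    refine ⟨⟨fun x y => J.graph.Adj x y ∧ ¬ r x y,
        ⟨fun x y h => ⟨h.1.symm, fun h' => h.2 (hc.symm h')⟩⟩, ⟨fun x h => h.2 (hc.refl _)⟩⟩,
      ⟨fun x y => x ≠ y ∧ ¬ J.graph.Adj x y ∧ r x y,
        ⟨fun x y h => ⟨h.1.symm, fun h' => h.2.1 h'.symm, hc.symm h.2.2⟩⟩,
        ⟨fun x h => h.1 rfl⟩⟩, fun x y h => h.1, fun x y h => ⟨h.1, h.2.1⟩, fun v => ?_, fun v => ?_,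
      isClusterGraph_of_equivalence (hc.comap Fin.val) fun x y => ?_⟩
    · refine ncard_le_of_subsingleton (fun x hx y hy => ?_) fun x hx => ?_
      · exact Fin.ext (hr.cut_unique v x y ((hG _ _).2 hx.1) hx.2 ((hG _ _).2 hy.1) hy.2)
      · rw [← hd]
        exact hr.cut v x ((hG _ _).2 hx.1) hx.2
    · refine ncard_le_of_subsingleton (fun x hx y hy => ?_) fun x hx => ?_
      · exact Fin.ext (hr.add_unique v x y (fun h => hx.1 (Fin.ext h))
          (fun h => hx.2.1 ((hG _ _).1 h)) hx.2.2 (fun h => hy.1 (Fin.ext h))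
          (fun h => hy.2.1 ((hG _ _).1 h)) hy.2.2)
      · rw [← ha]
        exact hr.add v x (fun h => hx.1 (Fin.ext h)) (fun h => hx.2.1 ((hG _ _).1 h)) hx.2.2
    · have := J.graph.ne_of_adj (a := x) (b := y)
      simp only [SimpleGraph.sup_adj, SimpleGraph.sdiff_adj]
      tauto

end ClusterEditing

namespace ClusterEditing

/-! ### Loop-free programs and nested loops -/

namespace Prog

/-- Programs without a `while` loop. -/
def LoopFree : Prog → Prop
  | skip => True
  | set _ _ => True
  | write _ _ _ _ => True
  | seq P Q => P.LoopFree ∧ Q.LoopFree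
  | ite _ P Q => P.LoopFree ∧ Q.LoopFree
  | .while _ _ => False

/-- The final memory of a loop-free program; the value on a `while` loop is arbitrary. -/
def out : Prog → Store → Store
  | skip, s => s
  | set x e, s => s.setReg x (e.eval s)
  | write A i j e, s => s.setArr A (i.eval s) (j.eval s) (e.eval s)
  | seq P Q, s => Q.out (P.out s)
  | ite e P Q, s => if e.eval s = 0 then Q.out s else P.out s
  | .while _ _, s => s

/-- A bound, independent of the memory, for the running time of a loop-free program. -/
def bound : Prog → ℕ
  | skip => 1
  | set _ e => e.cost + 1
  | write _ i j e => i.cost + j.cost + e.cost + 1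
  | seq P Q => P.bound + Q.bound
  | ite e P Q => e.cost + 1 + (P.bound + Q.bound)
  | .while _ _ => 0

theorem LoopFree.runs {P : Prog} (hP : P.LoopFree) (s : Store) :
    ∃ t, Runs P s (P.out s) t ∧ 1 ≤ t ∧ t ≤ P.bound := by
  induction P generalizing s with
  | skip => exact ⟨1, .skip s, le_rfl, le_rfl⟩
  | set x e => exact ⟨_, .set x e s, by omega, le_rfl⟩
  | write A i j e => exact ⟨_, .write A i j e s, by omega, le_rfl⟩
  | seq P Q ihP ihQ =>
    obtain ⟨t, h, h1, h2⟩ := ihP hP.1 s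
    obtain ⟨t', h', h1', h2'⟩ := ihQ hP.2 (P.out s)
    exact ⟨_, .seq h h', by omega, by simp only [bound]; omega⟩
  | ite e P Q ihP ihQ =>
    by_cases he : e.eval s = 0
    · obtain ⟨t, h, h1, h2⟩ := ihQ hP.2 s
      exact ⟨_, by simpa only [out, he, if_true] using Runs.ite_false he h, by omega,
        by simp only [bound]; omega⟩
    · obtain ⟨t, h, h1, h2⟩ := ihP hP.1 s
      exact ⟨_, by simpa only [out, he, if_false] using Runs.ite_true he h, by omega,
        by simp only [bound]; omega⟩
  | _ => exact hP.elim

/-- Nested loops: the program runs `P` once for every assignment of numbers below the content of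
register `N` to the registers in the list. -/
def forAll (N : ℕ) : List ℕ → Prog → Prog
  | [], P => P
  | x :: xs, P =>
    .seq (.set x (.const 0)) (.while (.sub (.reg N) (.reg x))
      (.seq (forAll N xs P) (.set x (.add (.reg x) (.const 1)))))

end Prog

/-- A bound for the running time of `k` nested loops, in the number of rounds of each loop, if the body
runs in time at most `B`. -/
noncomputable def forAllTime (B : ℕ) : ℕ → Polynomial ℕ
  | 0 => Polynomial.C B
  | k + 1 => Polynomial.X * (forAllTime B k + Polynomial.C 8) + Polynomial.C 6

/-- The rule for nested loops.  `Inv` is an invariant, `R t s s'` a transitive relation between the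
memory at the beginning and at the end of `t` steps, and `Q f s` says that the assignment `f` of the
loop registers has been dealt with in memory `s`.  If the body establishes `Q` for the current
assignment, and `R` preserves `Q`, then `Q` holds for all assignments at the end.  The list `L`
collects all loop registers; those outside `xs` belong to enclosing loops. -/
theorem forAll_runs {N n B : ℕ} {P : Prog} {L : List ℕ} (hN : N ∉ L)
    {Inv : Store → Prop} {R : ℕ → Store → Store → Prop} {Q : (ℕ → ℕ) → Store → Prop}
    (hInvN : ∀ s, Inv s → s.reg N = n)
    (hInv : ∀ s x c, x ∈ L → Inv s → Inv (s.setReg x c))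
    (hRset : ∀ s x c t, x ∈ L → R t s (s.setReg x c))
    (hRtrans : ∀ s s' s'' t t', R t s s' → R t' s' s'' → R (t + t') s s'')
    (hQ : ∀ f s s' t, R t s s' → Q f s → Q f s')
    (hP : ∀ s, Inv s → ∃ s' t, Runs P s s' t ∧ t ≤ B ∧ Inv s' ∧ R t s s' ∧
      (∀ y ∈ L, s'.reg y = s.reg y) ∧ ∀ f : ℕ → ℕ, (∀ y ∈ L, f y = s.reg y) → Q f s')
    (xs : List ℕ) (hxs : xs.Nodup) (hL : ∀ x ∈ xs, x ∈ L) (s : Store) (hs : Inv s) :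
    ∃ s' t, Runs (Prog.forAll N xs P) s s' t ∧ t ≤ (forAllTime B xs.length).eval n ∧ Inv s' ∧
      R t s s' ∧ (∀ y ∈ L, y ∉ xs → s'.reg y = s.reg y) ∧
      ∀ f : ℕ → ℕ, (∀ y ∈ xs, f y < n) → (∀ y ∈ L, y ∉ xs → f y = s.reg y) → Q f s' := by
  induction xs generalizing s with
  | nil =>
    obtain ⟨s', t, h1, h2, h3, h4, h5, h6⟩ := hP s hs
    exact ⟨s', t, h1, by simpa [forAllTime] using h2, h3, h4, fun y hy _ => h5 y hy,
      fun f _ hf => h6 f fun y hy => hf y hy (by simp)⟩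
  | cons x xs ih =>
    have hx : x ∈ L := hL x (by simp)
    have hxN : x ≠ N := fun h => hN (h ▸ hx)
    have hx' : x ∉ xs := (List.nodup_cons.1 hxs).1
    set T := (forAllTime B xs.length).eval n
    -- `k` is the number of rounds left; the assignments with `f x < s.reg x` are done.
    have loop : ∀ k s, Inv s → s.reg x + k = n →
        (∀ f : ℕ → ℕ, (∀ y ∈ xs, f y < n) → f x < s.reg x →
          (∀ y ∈ L, y ∉ x :: xs → f y = s.reg y) → Q f s) →
        ∃ s' t, Runs (.while (.sub (.reg N) (.reg x))
            (.seq (Prog.forAll N xs P) (.set x (.add (.reg x) (.const 1))))) s s' t ∧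
          t ≤ k * (T + 8) + 4 ∧ Inv s' ∧ R t s s' ∧
          (∀ y ∈ L, y ∉ x :: xs → s'.reg y = s.reg y) ∧
          ∀ f : ℕ → ℕ, (∀ y ∈ xs, f y < n) → f x < n →
            (∀ y ∈ L, y ∉ x :: xs → f y = s.reg y) → Q f s' := by
      intro k
      induction k with
      | zero =>
        intro s hs hk hdone
        refine ⟨s, _, .while_false ?_, by simp [Expr.cost], hs, ?_, fun _ _ _ => rfl,
          fun f h1 h2 h3 => hdone f h1 (by omega) h3⟩
        · simp only [Expr.eval, hInvN s hs]
          omega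
        · -- Overwriting a loop register by itself shows that `R` is reflexive.
          have := hRset s x (s.reg x) ((Expr.sub (.reg N) (.reg x)).cost + 1) hx
          convert this using 1
          cases s
          simp only [Store.setReg, Store.mk.injEq, and_true]
          funext y
          split_ifs with h <;> simp [*]
      | succ k ihk =>
        intro s hs hk hdone
        obtain ⟨s₁, t₁, r1, r2, r3, r4, r5, r6⟩ :=
          ih (List.nodup_cons.1 hxs).2 (fun y hy => hL y (by simp [hy])) s hs
        have hx1 : s₁.reg x = s.reg x := r5 x hx hx'
        set s₂ := s₁.setReg x (s₁.reg x + 1)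
        have hs₂ : Inv s₂ := hInv _ _ _ hx r3
        have hreg : ∀ y ∈ L, y ∉ x :: xs → s₂.reg y = s.reg y := by
          intro y hy hyx
          simp only [List.mem_cons, not_or] at hyx
          rw [← r5 y hy hyx.2]
          simp [s₂, Store.setReg, hyx.1]
        have hx2 : s₂.reg x = s.reg x + 1 := by simp [s₂, Store.setReg, hx1]
        have hdone₂ : ∀ f : ℕ → ℕ, (∀ y ∈ xs, f y < n) → f x < s₂.reg x →
            (∀ y ∈ L, y ∉ x :: xs → f y = s₂.reg y) → Q f s₂ := by
          intro f h1 h2 h3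
          refine hQ f _ _ _ (hRset s₁ x _ 0 hx) ?_
          have h3' : ∀ y ∈ L, y ∉ x :: xs → f y = s.reg y := fun y hy hyx => by
            rw [h3 y hy hyx, hreg y hy hyx]
          rcases (by omega : f x < s.reg x ∨ f x = s.reg x) with h | h
          · exact hQ f _ _ _ r4 (hdone f h1 h h3')
          · refine r6 f h1 fun y hy hyx => ?_
            by_cases hyx' : y = x
            · rw [hyx', h]
            · exact h3' y hy (by simp [hyx', hyx])
        obtain ⟨s₃, t₃, q1, q2, q3, q4, q5, q6⟩ := ihk s₂ hs₂ (by omega) hdone₂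
        refine ⟨s₃, _, .while_true ?_ (.seq r1 (.set x _ s₁)) q1, ?_, q3, ?_, ?_, ?_⟩
        · simp only [Expr.eval, hInvN s hs]
          omega
        · simp only [Expr.cost]
          have : t₁ ≤ T := r2
          rw [Nat.succ_mul]
          omega
        · have e1 := hRtrans _ _ _ _ _ r4 (hRset s₁ x (s₁.reg x + 1)
            ((Expr.add (.reg x) (.const 1)).cost + 1 + ((Expr.sub (.reg N) (.reg x)).cost + 1)) hx)
          have e2 := hRtrans _ _ _ _ _ e1 q4
          convert e2 using 1
          omega
        · intro y hy hyx
          rw [q5 y hy hyx, hreg y hy hyx]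
        · intro f h1 h2 h3
          exact q6 f h1 h2 fun y hy hyx => by rw [h3 y hy hyx, hreg y hy hyx]
    obtain ⟨s', t, h1, h2, h3, h4, h5, h6⟩ := loop n (s.setReg x 0) (hInv s x 0 hx hs)
      (by simp [Store.setReg]) (fun f _ hf => by simp [Store.setReg] at hf)
    have hreg : ∀ y, y ∉ x :: xs → (s.setReg x 0).reg y = s.reg y := by
      intro y hy
      simp only [List.mem_cons, not_or] at hy
      simp [Store.setReg, hy.1]
    refine ⟨s', _, .seq (.set x _ s) h1, ?_, h3, hRtrans _ _ _ _ _ (hRset _ _ _ _ hx) h4, ?_, ?_⟩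
    · simp only [List.length_cons, forAllTime, Polynomial.eval_add, Polynomial.eval_mul,
        Polynomial.eval_X, Polynomial.eval_C, Expr.cost]
      have : t ≤ n * ((forAllTime B xs.length).eval n + 8) + 4 := h2
      omega
    · intro y hy hyx
      rw [h5 y hy hyx, hreg y hyx]
    · intro f hf hf'
      refine h6 f (fun y hy => hf y (by simp [hy])) (hf x (by simp)) fun y hy hyx => ?_
      rw [hf' y hy hyx, hreg y hyx]

end ClusterEditing

namespace ClusterEditing

/-! ### The program that treats one square -/

namespace Expr

/-- Tests take the value `0` if they fail.  This one tests that the vertices in registers `x` and `y`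
are not adjacent. -/
def notAdj (x y : ℕ) : Expr := .sub (.const 1) (.read 0 (.reg x) (.reg y))

/-- The test that registers `x` and `y` agree. -/
def equal (x y : ℕ) : Expr :=
  .sub (.const 1) (.add (.sub (.reg x) (.reg y)) (.sub (.reg y) (.reg x)))

/-- The test that the vertex in register `x` has weight `0` in array `A`. -/
def noWeight (A x : ℕ) : Expr := .sub (.const 1) (.read A (.reg x) (.const 0))

/-- The disjunction of tests. -/
def any : List Expr → Expr
  | [] => .const 0
  | e :: es => .add e (any es)

theorem eval_any (s : Store) (es : List Expr) : (any es).eval s = 0 ↔ ∀ e ∈ es, e.eval s = 0 := by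
  induction es with
  | nil => simp [any, eval]
  | cons e es ih => simp [any, eval, ih]

theorem eval_equal (s : Store) (x y : ℕ) : (equal x y).eval s = 0 ↔ s.reg x ≠ s.reg y := by
  simp only [equal, eval]
  omega

theorem eval_noWeight (s : Store) (A x : ℕ) : (noWeight A x).eval s = 0 ↔ s.arr A (s.reg x) 0 ≠ 0 := by
  simp only [noWeight, eval]
  omega

/-- The test that registers `3, …, 10` do not hold a cubic square `v₁, v₂, v₃, v₄, u₁, u₂, u₃, u₄`. -/
def notSquare : Expr :=
  any [notAdj 3 4, notAdj 4 5, notAdj 5 6, notAdj 6 3, equal 3 5, equal 4 6,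
    notAdj 3 7, notAdj 4 8, notAdj 5 9, notAdj 6 10, equal 7 4, equal 7 6, equal 8 5, equal 8 3,
    equal 9 6, equal 9 4, equal 10 3, equal 10 5]

/-- The test that one of the weights of the vertices `v₁, v₂, v₃, v₄` is `0`. -/
def missingWeight : Expr :=
  any [noWeight 1 3, noWeight 1 4, noWeight 1 5, noWeight 1 6,
    noWeight 2 3, noWeight 2 4, noWeight 2 5, noWeight 2 6]

end Expr

namespace Prog

/-- Replaces the stored graph by its `bypass` along the square in registers `x₁, x₂, x₃, x₄`.  The new
vertices are `n` and `n + 1`, where `n` is the order, and their weights are `1`. -/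
def bypass (x₁ x₂ x₃ x₄ : ℕ) : Prog :=
  .seq (.write 0 (.reg x₁) (.reg x₄) (.const 0)) <|
  .seq (.write 0 (.reg x₄) (.reg x₁) (.const 0)) <|
  .seq (.write 0 (.reg x₂) (.reg x₃) (.const 0)) <|
  .seq (.write 0 (.reg x₃) (.reg x₂) (.const 0)) <|
  .seq (.write 0 (.reg x₂) (.reg 0) (.const 1)) <|
  .seq (.write 0 (.reg 0) (.reg x₂) (.const 1)) <|
  .seq (.write 0 (.reg 0) (.add (.reg 0) (.const 1)) (.const 1)) <|
  .seq (.write 0 (.add (.reg 0) (.const 1)) (.reg 0) (.const 1)) <|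
  .seq (.write 0 (.add (.reg 0) (.const 1)) (.reg x₃) (.const 1)) <|
  .seq (.write 0 (.reg x₃) (.add (.reg 0) (.const 1)) (.const 1)) <|
  .seq (.write 1 (.reg 0) (.const 0) (.const 1)) <|
  .seq (.write 1 (.add (.reg 0) (.const 1)) (.const 0) (.const 1)) <|
  .seq (.write 2 (.reg 0) (.const 0) (.const 1)) <|
  .seq (.write 2 (.add (.reg 0) (.const 1)) (.const 0) (.const 1)) <|
  .set 0 (.add (.reg 0) (.const 2))

/-- Removes the edge between the vertices in registers `x` and `y`, with their deletion budget. -/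
def deleteEdge (x y : ℕ) : Prog :=
  .seq (.write 0 (.reg x) (.reg y) (.const 0)) <|
  .seq (.write 0 (.reg y) (.reg x) (.const 0)) <|
  .seq (.write 2 (.reg x) (.const 0) (.const 0)) <|
  .write 2 (.reg y) (.const 0) (.const 0)

/-- Gives the verdict NO. -/
def reject : Prog := .set 1 (.const 0)

/-- The body of the loops.  If there is no verdict yet and registers `3, …, 10` hold a cubic square, the
square is destroyed: it is bypassed if it can be cut into opposite edges, in either direction, and
otherwise the forced deletion of `v₁u₁` is carried out. -/
def reduceSquare : Prog :=
  .ite (.reg 1)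
    (.ite .notSquare .skip <|
      .ite .missingWeight reject <|
      .ite (.any [.notAdj 7 8, .notAdj 9 10])
        (.ite (.any [.notAdj 8 9, .notAdj 10 7])
          (.ite (.noWeight 2 7) reject (deleteEdge 3 7))
          (bypass 4 5 6 3))
        (bypass 3 4 5 6))
    .skip

theorem loopFree_reduceSquare : reduceSquare.LoopFree := by
  simp [reduceSquare, LoopFree, bypass, deleteEdge, reject]

theorem bypass_out_reg (x₁ x₂ x₃ x₄ : ℕ) (s : Store) (y : ℕ) :
    ((bypass x₁ x₂ x₃ x₄).out s).reg y = if y = 0 then s.reg 0 + 2 else s.reg y := by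
  simp [bypass, out, Store.setReg, Store.setArr, Expr.eval]

theorem bypass_out_arr_zero (x₁ x₂ x₃ x₄ : ℕ) (s : Store) (i j : ℕ) :
    ((bypass x₁ x₂ x₃ x₄).out s).arr 0 i j =
      if (i = s.reg x₂ ∧ j = s.reg 0) ∨ (i = s.reg 0 ∧ j = s.reg x₂) ∨
          (i = s.reg 0 ∧ j = s.reg 0 + 1) ∨ (i = s.reg 0 + 1 ∧ j = s.reg 0) ∨
          (i = s.reg 0 + 1 ∧ j = s.reg x₃) ∨ (i = s.reg x₃ ∧ j = s.reg 0 + 1) then 1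
      else if (i = s.reg x₁ ∧ j = s.reg x₄) ∨ (i = s.reg x₄ ∧ j = s.reg x₁) ∨
          (i = s.reg x₂ ∧ j = s.reg x₃) ∨ (i = s.reg x₃ ∧ j = s.reg x₂) then 0
      else s.arr 0 i j := by
  simp only [bypass, out, Store.setReg, Store.setArr, Expr.eval, true_and, OfNat.zero_ne_ofNat, zero_ne_one, false_and, if_false]
  grind

theorem bypass_out_arr_weight (x₁ x₂ x₃ x₄ : ℕ) (s : Store) {A : ℕ} (hA : A = 1 ∨ A = 2) (i : ℕ) :
    ((bypass x₁ x₂ x₃ x₄).out s).arr A i 0 =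
      if i = s.reg 0 + 1 then 1 else if i = s.reg 0 then 1 else s.arr A i 0 := by
  rcases hA with rfl | rfl <;>
  simp [bypass, out, Store.setReg, Store.setArr, Expr.eval]

theorem deleteEdge_out_reg (x y : ℕ) (s : Store) : ((deleteEdge x y).out s).reg = s.reg := by
  simp [deleteEdge, out, Store.setArr]

theorem deleteEdge_out_arr_zero (x y : ℕ) (s : Store) (i j : ℕ) :
    ((deleteEdge x y).out s).arr 0 i j =
      if (i = s.reg x ∧ j = s.reg y) ∨ (i = s.reg y ∧ j = s.reg x) then 0 else s.arr 0 i j := by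
  simp only [deleteEdge, out, Store.setArr, Expr.eval, true_and, OfNat.zero_ne_ofNat, false_and, if_false]
  grind

theorem deleteEdge_out_arr_one (x y : ℕ) (s : Store) (i : ℕ) :
    ((deleteEdge x y).out s).arr 1 i 0 = s.arr 1 i 0 := by
  simp [deleteEdge, out, Store.setArr, Expr.eval]

theorem deleteEdge_out_arr_two (x y : ℕ) (s : Store) (i : ℕ) :
    ((deleteEdge x y).out s).arr 2 i 0 =
      if i = s.reg y then 0 else if i = s.reg x then 0 else s.arr 2 i 0 := by
  simp [deleteEdge, out, Store.setArr, Expr.eval]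

end Prog

/-- The memory `s` holds the triangle-free graph `G` of maximum degree at most `3`, with vertices below
register `0`, and weights at most `1`.  All cells of array `0` outside the graph are `0`, so that new
vertices start out isolated. -/
structure Store.Encodes (s : Store) (G : SimpleGraph ℕ) : Prop where
  subcubic : IsSubcubic G
  arr_eq_one : ∀ i j, s.arr 0 i j = 1 ↔ G.Adj i j
  arr_le : ∀ i j, s.arr 0 i j ≤ 1
  lt : ∀ i j, G.Adj i j → i < s.reg 0
  weight_le : ∀ A i, A = 1 ∨ A = 2 → s.arr A i 0 ≤ 1

/-- The graph `G` with the weights stored in `s` has a solution. -/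
def Store.IsYes (s : Store) (G : SimpleGraph ℕ) : Prop :=
  Clusterable G (fun i => s.arr 1 i 0) fun i => s.arr 2 i 0

namespace Store.Encodes
variable {s : Store} {G : SimpleGraph ℕ} (h : s.Encodes G)
include h

theorem eval_notAdj (x y : ℕ) : (Expr.notAdj x y).eval s = 0 ↔ G.Adj (s.reg x) (s.reg y) := by
  rw [← h.arr_eq_one]
  have := h.arr_le (s.reg x) (s.reg y)
  simp only [Expr.notAdj, Expr.eval]
  omega

theorem eval_notSquare : Expr.notSquare.eval s = 0 ↔
    IsCubicSquare G (s.reg 3) (s.reg 4) (s.reg 5) (s.reg 6) (s.reg 7) (s.reg 8) (s.reg 9)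
      (s.reg 10) := by
  simp only [Expr.notSquare, Expr.eval_any, List.forall_mem_cons, Expr.eval_equal, h.eval_notAdj]
  constructor
  · rintro ⟨h1, h2, h3, h4, h5, h6, h7, h8, h9, h10, h11, h12, h13, h14, h15, h16, h17, h18, -⟩
    exact ⟨h1, h2, h3, h4, h5, h6, h7, h8, h9, h10, h11, h12, h13, h14, h15, h16, h17, h18⟩
  · rintro ⟨h1, h2, h3, h4, h5, h6, h7, h8, h9, h10, h11, h12, h13, h14, h15, h16, h17, h18⟩
    exact ⟨h1, h2, h3, h4, h5, h6, h7, h8, h9, h10, h11, h12, h13, h14, h15, h16, h17, h18,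
      by simp⟩

/-- The last two conclusions say that the new graph has no cubic square with the vertex `v₁` in first or
second position; both positions are needed, as the square can be bypassed in two directions. -/
theorem bypass {x₁ x₂ x₃ x₄ : ℕ} {u₁ u₂ u₃ u₄ : ℕ}
    (hsq : IsCubicSquare G (s.reg x₁) (s.reg x₂) (s.reg x₃) (s.reg x₄) u₁ u₂ u₃ u₄)
    (h₁₂ : G.Adj u₁ u₂) (h₃₄ : G.Adj u₃ u₄)
    (hw : ∀ A, A = 1 ∨ A = 2 → s.arr A (s.reg x₁) 0 ≠ 0 ∧ s.arr A (s.reg x₂) 0 ≠ 0 ∧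
      s.arr A (s.reg x₃) 0 ≠ 0 ∧ s.arr A (s.reg x₄) 0 ≠ 0) :
    ∃ G' : SimpleGraph ℕ, ((Prog.bypass x₁ x₂ x₃ x₄).out s).Encodes G' ∧
      (((Prog.bypass x₁ x₂ x₃ x₄).out s).IsYes G' ↔ s.IsYes G) ∧
      (∀ y₁ y₂ y₃ y₄ z₁ z₂ z₃ z₄, IsCubicSquare G' y₁ y₂ y₃ y₄ z₁ z₂ z₃ z₄ →
        IsCubicSquare G y₁ y₂ y₃ y₄ z₁ z₂ z₃ z₄ ∧ y₁ ≠ s.reg x₁ ∧ y₂ ≠ s.reg x₁) := by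
  have hlt1 := h.lt _ _ hsq.adj₁₂
  have hlt2 := h.lt _ _ hsq.adj₂₃
  have hlt3 := h.lt _ _ hsq.adj₃₄
  have hlt4 := h.lt _ _ hsq.adj₄₁
  have hb : IsBypassable G (s.reg x₁) (s.reg x₂) (s.reg x₃) (s.reg x₄) u₁ u₂ u₃ u₄ (s.reg 0)
      (s.reg 0 + 1) :=
    { toIsCubicSquare := hsq
      subcubic := h.subcubic
      adj_u₁₂ := h₁₂
      adj_u₃₄ := h₃₄
      not_adj_z := fun x hx => by have := h.lt _ _ hx.symm; omega
      not_adj_w := fun x hx => by have := h.lt _ _ hx.symm; omega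
      ne_zw := by omega }
  have hW := fun A hA i => Prog.bypass_out_arr_weight x₁ x₂ x₃ x₄ s (A := A) hA i
  refine ⟨ClusterEditing.bypass G (s.reg x₁) (s.reg x₂) (s.reg x₃) (s.reg x₄) (s.reg 0)
    (s.reg 0 + 1), ⟨hb.isSubcubic, fun i j => ?_, fun i j => ?_, fun i j => ?_, fun A i hA => ?_⟩,
    ?_, ?_⟩
  · rw [Prog.bypass_out_arr_zero, bypass_adj, ← h.arr_eq_one]
    split_ifs <;> grind
  · rw [Prog.bypass_out_arr_zero]
    have := h.arr_le i j
    split_ifs <;> omega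
  · rw [Prog.bypass_out_reg, bypass_adj, if_pos rfl]
    rintro (h' | h')
    · have := h.lt i j h'.1
      omega
    · omega
  · rw [hW A hA]
    have := h.weight_le A i hA
    split_ifs <;> omega
  · unfold Store.IsYes
    simp only [hW 1 (Or.inl rfl), hW 2 (Or.inr rfl)]
    have hw1 := hw 1 (Or.inl rfl)
    have hw2 := hw 2 (Or.inr rfl)
    rw [hb.clusterable_bypass_iff]
    · constructor <;> refine fun hG => hG.of_eq_of_adj fun x y hxy => ?_
      all_goals
        have := h.lt _ _ hxy
        rw [if_neg (by omega), if_neg (by omega), if_neg (by omega), if_neg (by omega)]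
        exact ⟨rfl, rfl⟩
    all_goals grind
  · exact fun _ _ _ _ _ _ _ _ h' =>
      ⟨hb.isCubicSquare h', (hb.corner_ne h').1, (hb.corner_ne h'.rotate).1⟩

theorem deleteEdge {x y : ℕ} (hxy : G.Adj (s.reg x) (s.reg y)) (hy : s.arr 2 (s.reg y) 0 ≠ 0)
    (hx : s.arr 2 (s.reg x) 0 ≠ 0)
    (hcut : ∀ r, IsClustering G (fun i => s.arr 1 i 0) (fun i => s.arr 2 i 0) r →
      ¬ r (s.reg x) (s.reg y)) :
    ((Prog.deleteEdge x y).out s).Encodes (G.deleteEdges {s(s.reg x, s.reg y)}) ∧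
      (((Prog.deleteEdge x y).out s).IsYes (G.deleteEdges {s(s.reg x, s.reg y)}) ↔ s.IsYes G) := by
  have hle := G.deleteEdges_le {s(s.reg x, s.reg y)}
  refine ⟨⟨h.subcubic.anti hle, fun i j => ?_, fun i j => ?_, fun i j h' => ?_,
    fun A i hA => ?_⟩, ?_⟩
  · rw [Prog.deleteEdge_out_arr_zero, SimpleGraph.deleteEdges_adj, ← h.arr_eq_one]
    simp only [Set.mem_singleton_iff, Sym2.eq_iff]
    split_ifs <;> grind
  · rw [Prog.deleteEdge_out_arr_zero]
    have := h.arr_le i j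
    split_ifs <;> omega
  · rw [Prog.deleteEdge_out_reg]
    exact h.lt i j (hle h')
  · have := h.weight_le A i hA
    rcases hA with rfl | rfl
    · rwa [Prog.deleteEdge_out_arr_one]
    · rw [Prog.deleteEdge_out_arr_two]
      split_ifs <;> omega
  · unfold Store.IsYes
    rw [clusterable_deleteEdge h.subcubic hxy hcut]
    have : Function.update (Function.update (fun i => s.arr 2 i 0) (s.reg x) 0) (s.reg y) 0 =
        fun i => ((Prog.deleteEdge x y).out s).arr 2 i 0 := by
      funext i
      simp [Prog.deleteEdge_out_arr_two, Function.update_apply]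
    rw [this]
    simp only [Prog.deleteEdge_out_arr_one]
    tauto

end Store.Encodes
end ClusterEditing

namespace ClusterEditing

/-! ### Correctness of the reduction -/

theorem Store.Encodes.unique {s : Store} {G G' : SimpleGraph ℕ} (h : s.Encodes G)
    (h' : s.Encodes G') : G = G' := by
  ext i j
  rw [← h.arr_eq_one, h'.arr_eq_one]

theorem Store.Encodes.congr {s s' : Store} {G : SimpleGraph ℕ} (h : s.Encodes G)
    (harr : s'.arr = s.arr) (hreg : s'.reg 0 = s.reg 0) : s'.Encodes G where
  subcubic := h.subcubic
  arr_eq_one := harr ▸ h.arr_eq_one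
  arr_le := harr ▸ h.arr_le
  lt := hreg ▸ h.lt
  weight_le := harr ▸ h.weight_le

theorem Store.IsYes.congr {s s' : Store} (G : SimpleGraph ℕ) (harr : s'.arr = s.arr) :
    s'.IsYes G ↔ s.IsYes G := by
  simp only [Store.IsYes, harr]

theorem reduceSquare_out_reg (s : Store) :
    (Prog.reduceSquare.out s).reg 0 ≤ s.reg 0 + 2 ∧
      ∀ y, 2 ≤ y → (Prog.reduceSquare.out s).reg y = s.reg y := by
  let K (P : Prog) : Prop := (P.out s).reg 0 ≤ s.reg 0 + 2 ∧ ∀ y, 2 ≤ y → (P.out s).reg y = s.reg y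
  have hite : ∀ e P Q, K P → K Q → K (.ite e P Q) := by
    intro e P Q hP hQ
    by_cases he : e.eval s = 0
    · simpa only [K, Prog.out, he, if_true] using hQ
    · simpa only [K, Prog.out, he, if_false] using hP
  have hskip : K .skip := ⟨Nat.le_add_right _ _, fun _ _ => rfl⟩
  have hreject : K .reject := by
    refine ⟨by simp [Prog.out, Prog.reject, Store.setReg], fun y hy => ?_⟩
    simp only [Prog.out, Prog.reject, Store.setReg]
    rw [if_neg (by omega)]
  have hdelete : ∀ x y, K (.deleteEdge x y) := fun x y => by
    simp [K, Prog.deleteEdge_out_reg]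
  have hbypass : ∀ x₁ x₂ x₃ x₄, K (.bypass x₁ x₂ x₃ x₄) := by
    refine fun x₁ x₂ x₃ x₄ => ⟨by simp [Prog.bypass_out_reg], fun y hy => ?_⟩
    rw [Prog.bypass_out_reg, if_neg (by omega)]
  exact hite _ _ _ (hite _ _ _ hskip (hite _ _ _ hreject (hite _ _ _ (hite _ _ _
    (hite _ _ _ hreject (hdelete _ _)) (hbypass _ _ _ _)) (hbypass _ _ _ _)))) hskip

/-- One execution of the body preserves the answer or correctly gives the verdict NO; it creates no
cubic squares, and destroys the one in the loop registers. -/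
theorem reduceSquare_out {s : Store} {G : SimpleGraph ℕ} (h : s.Encodes G) (h1 : s.reg 1 = 2) :
    ((Prog.reduceSquare.out s).reg 1 = 0 ∧ ¬ s.IsYes G) ∨
    ((Prog.reduceSquare.out s).reg 1 = 2 ∧ ∃ G', (Prog.reduceSquare.out s).Encodes G' ∧
      ((Prog.reduceSquare.out s).IsYes G' ↔ s.IsYes G) ∧
      (∀ y₁ y₂ y₃ y₄ z₁ z₂ z₃ z₄, IsCubicSquare G' y₁ y₂ y₃ y₄ z₁ z₂ z₃ z₄ →
        IsCubicSquare G y₁ y₂ y₃ y₄ z₁ z₂ z₃ z₄) ∧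
      ¬ IsCubicSquare G' (s.reg 3) (s.reg 4) (s.reg 5) (s.reg 6) (s.reg 7) (s.reg 8) (s.reg 9)
        (s.reg 10)) := by
  have h1' : (Expr.reg 1).eval s ≠ 0 := by simp [Expr.eval, h1]
  simp only [Prog.reduceSquare, Prog.out, if_neg h1']
  by_cases hsq : Expr.notSquare.eval s = 0
  swap
  · rw [if_neg hsq]
    exact Or.inr ⟨h1, G, h, Iff.rfl, fun _ _ _ _ _ _ _ _ h' => h', h.eval_notSquare.not.1 hsq⟩
  rw [if_pos hsq]
  rw [h.eval_notSquare] at hsq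
  have hno : ((Prog.reject).out s).reg 1 = 0 := by simp [Prog.reject, Prog.out, Store.setReg, Expr.eval]
  by_cases hw : Expr.missingWeight.eval s = 0
  swap
  · rw [if_neg hw]
    refine Or.inl ⟨hno, fun ⟨r, hr⟩ => hw ?_⟩
    have w1 := hr.weight_ne_zero h.subcubic hsq
    have w2 := hr.weight_ne_zero h.subcubic hsq.rotate
    have w3 := hr.weight_ne_zero h.subcubic hsq.rotate.rotate
    have w4 := hr.weight_ne_zero h.subcubic hsq.rotate.rotate.rotate
    simp only [Expr.missingWeight, Expr.eval_any, List.forall_mem_cons, Expr.eval_noWeight]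
    exact ⟨w1.1, w2.1, w3.1, w4.1, w1.2, w2.2, w3.2, w4.2, by simp⟩
  rw [if_pos hw]
  simp only [Expr.missingWeight, Expr.eval_any, List.forall_mem_cons, Expr.eval_noWeight] at hw
  obtain ⟨a1, a2, a3, a4, d1, d2, d3, d4, -⟩ := hw
  have e1 := Expr.eval_any s [.notAdj 7 8, .notAdj 9 10]
  have e2 := Expr.eval_any s [.notAdj 8 9, .notAdj 10 7]
  simp only [List.forall_mem_cons, h.eval_notAdj, List.not_mem_nil, false_imp_iff, implies_true,
    and_true] at e1 e2
  by_cases h₁ : (Expr.any [.notAdj 7 8, .notAdj 9 10]).eval s = 0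
  · rw [if_pos h₁]
    rw [e1] at h₁
    obtain ⟨G', b1, b2, b3⟩ := h.bypass (x₁ := 3) (x₂ := 4) (x₃ := 5) (x₄ := 6) hsq h₁.1 h₁.2
      (by rintro A (rfl | rfl); exacts [⟨a1, a2, a3, a4⟩, ⟨d1, d2, d3, d4⟩])
    refine Or.inr ⟨by simp [Prog.bypass_out_reg, h1], G', b1, b2,
      fun _ _ _ _ _ _ _ _ h' => (b3 _ _ _ _ _ _ _ _ h').1,
      fun h' => (b3 _ _ _ _ _ _ _ _ h').2.1 rfl⟩
  rw [if_neg h₁]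
  rw [e1] at h₁
  by_cases h₂ : (Expr.any [.notAdj 8 9, .notAdj 10 7]).eval s = 0
  · rw [if_pos h₂]
    rw [e2] at h₂
    obtain ⟨G', b1, b2, b3⟩ := h.bypass (x₁ := 4) (x₂ := 5) (x₃ := 6) (x₄ := 3) hsq.rotate h₂.1 h₂.2
      (by rintro A (rfl | rfl); exacts [⟨a2, a3, a4, a1⟩, ⟨d2, d3, d4, d1⟩])
    refine Or.inr ⟨by simp [Prog.bypass_out_reg, h1], G', b1, b2,
      fun _ _ _ _ _ _ _ _ h' => (b3 _ _ _ _ _ _ _ _ h').1,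
      fun h' => (b3 _ _ _ _ _ _ _ _ h').2.2 rfl⟩
  rw [if_neg h₂]
  rw [e2] at h₂
  have hcut := fun r (hr : IsClustering G (fun i => s.arr 1 i 0) (fun i => s.arr 2 i 0) r) =>
    hr.not_rel_of_not_adj h.subcubic hsq h₁ h₂
  by_cases h₃ : (Expr.noWeight 2 7).eval s = 0
  swap
  · rw [if_neg h₃]
    rw [Expr.eval_noWeight] at h₃
    exact Or.inl ⟨hno, fun ⟨r, hr⟩ => h₃ (hr.cut _ _ hsq.adj₁.symm fun h' =>
      hcut r hr (hr.equiv.symm h'))⟩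
  rw [if_pos h₃]
  rw [Expr.eval_noWeight] at h₃
  obtain ⟨b1, b2⟩ := h.deleteEdge (x := 3) (y := 7) hsq.adj₁ h₃ d1 hcut
  refine Or.inr ⟨by rw [Prog.deleteEdge_out_reg, h1], _, b1, b2,
    fun _ _ _ _ _ _ _ _ h' => h'.mono (SimpleGraph.deleteEdges_le _), fun h' => ?_⟩
  have := h'.adj₁
  simp at this

theorem subset_triple_of_ncard_le {α : Type*} [Finite α] {s : Set α} (hs : s.ncard ≤ 3) (x : α) :
    ∃ p q r, s ⊆ {p, q, r} := by
  rcases (by omega : s.ncard = 0 ∨ s.ncard = 1 ∨ s.ncard = 2 ∨ s.ncard = 3) with h | h | h | h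
  · rw [Set.ncard_eq_zero (Set.toFinite s)] at h
    exact ⟨x, x, x, by simp [h]⟩
  · obtain ⟨p, rfl⟩ := Set.ncard_eq_one.1 h
    exact ⟨p, p, p, by simp⟩
  · obtain ⟨p, q, -, rfl⟩ := Set.ncard_eq_two.1 h
    exact ⟨p, q, q, by simp⟩
  · obtain ⟨p, q, r, -, -, -, rfl⟩ := Set.ncard_eq_three.1 h
    exact ⟨p, q, r, subset_rfl⟩

theorem map_val_adj {n : ℕ} (G : SimpleGraph (Fin n)) (i j : ℕ) :
    (G.map Fin.valEmbedding).Adj i j ↔ ∃ (hi : i < n) (hj : j < n), G.Adj ⟨i, hi⟩ ⟨j, hj⟩ := by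
  constructor
  · intro h
    obtain ⟨x, y, hxy, rfl, rfl⟩ := (SimpleGraph.map_adj Fin.valEmbedding G i j).1 h
    exact ⟨x.2, y.2, hxy⟩
  · rintro ⟨hi, hj, h⟩
    exact (SimpleGraph.map_adj Fin.valEmbedding G i j).2 ⟨_, _, h, rfl, rfl⟩

theorem isSubcubic_map {n : ℕ} {G : SimpleGraph (Fin n)} (hG : G ∈ classG2 n) :
    IsSubcubic (G.map Fin.valEmbedding) where
  triangle_free x y z := by
    simp only [map_val_adj]
    rintro ⟨hx, hy, hxy⟩ ⟨_, hz, hyz⟩ ⟨_, _, hxz⟩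
    exact hG.1 _ (SimpleGraph.is3Clique_triple_iff.2 ⟨hxy, hxz, hyz⟩)
  degree_le v := by
    simp only [map_val_adj]
    by_cases hv : v < n
    · obtain ⟨p, q, s, h⟩ := subset_triple_of_ncard_le (hG.2 ⟨v, hv⟩) ⟨v, hv⟩
      refine ⟨p, q, s, ?_⟩
      rintro x ⟨_, hx, hvx⟩
      simpa [Fin.ext_iff] using h hvx
    · exact ⟨v, v, v, fun x hx => absurd hx.1 hv⟩

theorem encodes_toStore (I : Instance 1 1) (hI : I.graph ∈ classG2 I.order) :
    I.toStore.Encodes (I.graph.map Fin.valEmbedding) := by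
  refine ⟨isSubcubic_map hI, fun i j => ?_, fun i j => ?_, fun i j h => ?_, ?_⟩
  · rw [map_val_adj]
    simp [Instance.toStore]
  · simp only [Instance.toStore, if_true]
    split_ifs <;> omega
  · exact ((map_val_adj _ i j).1 h).1
  · rintro A i (rfl | rfl)
    · simp only [Instance.toStore, one_ne_zero, if_false, if_true]
      split_ifs <;> omega
    · simp only [Instance.toStore, OfNat.ofNat_ne_zero, OfNat.ofNat_ne_one, if_false, if_true]
      split_ifs <;> omega

theorem isYes_toStore (I : Instance 1 1) :
    I.toStore.IsYes (I.graph.map Fin.valEmbedding) ↔ I.IsYes := by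
  refine (I.isYes_iff (fun i j => ?_) ?_ (fun i => ?_) fun i => ?_).symm
  · rw [map_val_adj]
    simp
  · exact fun i j h => ((map_val_adj _ i j).1 h).1
  · simp [Instance.toStore]
  · simp [Instance.toStore]

/-- The instance stored in `s`, whose graph is `G`. -/
def Store.toInstance (s : Store) (G : SimpleGraph ℕ) : Instance 1 1 where
  order := s.reg 0
  graph := G.comap Fin.val
  add i := Fin.ofNat 2 (s.arr 1 i 0)
  del i := Fin.ofNat 2 (s.arr 2 i 0)

namespace Store.Encodes
variable {s : Store} {G : SimpleGraph ℕ} (h : s.Encodes G)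
include h

theorem val_ofNat {A : ℕ} (hA : A = 1 ∨ A = 2) (i : ℕ) :
    (Fin.ofNat 2 (s.arr A i 0) : ℕ) = s.arr A i 0 :=
  Nat.mod_eq_of_lt (Nat.lt_succ_of_le (h.weight_le A i hA))

theorem contains_toInstance : s.Contains (s.toInstance G) := by
  refine ⟨rfl, fun i j => ?_, fun i => (h.val_ofNat (Or.inl rfl) i).symm,
    fun i => (h.val_ofNat (Or.inr rfl) i).symm⟩
  have h1 := h.arr_eq_one i j
  have h2 := h.arr_le i j
  by_cases h3 : (s.toInstance G).graph.Adj i j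
  · rw [if_pos h3]
    exact h1.2 h3
  · rw [if_neg h3]
    have := h1.not.2 h3
    omega

theorem isYes_toInstance : (s.toInstance G).IsYes ↔ s.IsYes G :=
  Instance.isYes_iff _ (fun _ _ => Iff.rfl) h.lt (fun i => (h.val_ofNat (Or.inl rfl) i).symm)
    fun i => (h.val_ofNat (Or.inr rfl) i).symm

theorem toInstance_mem_classG2 : (s.toInstance G).graph ∈ classG2 (s.toInstance G).order := by
  refine ⟨fun t ht => ?_, fun v => ?_⟩
  · obtain ⟨x, y, z, hxy, hxz, hyz, -⟩ := SimpleGraph.is3Clique_iff.1 ht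
    exact h.subcubic.triangle_free x y z hxy hyz hxz
  · obtain ⟨p, q, t, hp⟩ := h.subcubic.degree_le v
    have hsub : Fin.val '' ((s.toInstance G).graph.neighborSet v) ⊆ {p, q, t} := by
      rintro _ ⟨x, hx, rfl⟩
      exact hp x hx
    rw [← Set.ncard_image_of_injective _ Fin.val_injective]
    refine (Set.ncard_le_ncard hsub (Set.toFinite _)).trans ?_
    refine (Set.ncard_insert_le _ _).trans (Nat.succ_le_succ ?_)
    exact (Set.ncard_insert_le _ _).trans (by simp)

theorem toInstance_mem_classG3
    (hsq : ∀ v₁ v₂ v₃ v₄ u₁ u₂ u₃ u₄, ¬ IsCubicSquare G v₁ v₂ v₃ v₄ u₁ u₂ u₃ u₄) :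
    (s.toInstance G).graph ∈ classG3 (s.toInstance G).order := by
  refine ⟨h.toInstance_mem_classG2, ?_⟩
  rintro ⟨v₁, v₂, v₃, v₄, ⟨h12, h23, h34, h41, h13, h24⟩, c1, c2, c3, c4⟩
  have key : ∀ v x y : Fin (s.toInstance G).order,
      ((s.toInstance G).graph.neighborSet v).ncard = 3 →
      ∃ u : Fin (s.toInstance G).order, (s.toInstance G).graph.Adj v u ∧ u ≠ x ∧ u ≠ y := by
    intro v x y hv
    by_contra! hn
    have hsub : (s.toInstance G).graph.neighborSet v ⊆ {x, y} := by
      intro u hu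
      by_cases hux : u = x
      · exact Or.inl hux
      · exact Or.inr (hn u hu hux)
    have := (Set.ncard_le_ncard hsub (Set.toFinite _)).trans (Set.ncard_insert_le x {y})
    rw [Set.ncard_singleton] at this
    omega
  obtain ⟨u₁, a1, b1, b1'⟩ := key v₁ v₂ v₄ c1
  obtain ⟨u₂, a2, b2, b2'⟩ := key v₂ v₃ v₁ c2
  obtain ⟨u₃, a3, b3, b3'⟩ := key v₃ v₄ v₂ c3
  obtain ⟨u₄, a4, b4, b4'⟩ := key v₄ v₁ v₃ c4
  have hne : ∀ {x y : Fin (s.toInstance G).order}, x ≠ y → (x : ℕ) ≠ y := fun h h' => h (Fin.ext h')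
  exact hsq v₁ v₂ v₃ v₄ u₁ u₂ u₃ u₄ ⟨h12, h23, h34, h41, hne h13, hne h24, a1, a2, a3, a4, hne b1,
    hne b1', hne b2, hne b2', hne b3, hne b3', hne b4, hne b4'⟩

end Store.Encodes

/-- The reduction: register `1` holds the verdict, register `2` the original order, and the loops run
over all `8`-tuples of original vertices. -/
def Prog.reduction : Prog :=
  .seq (.set 1 (.const 2)) <| .seq (.set 2 (.reg 0)) <|
    .forAll 2 [3, 4, 5, 6, 7, 8, 9, 10] .reduceSquare

/-- In `R`, besides the growth of the order, it is recorded that cubic squares are never created: so a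
tuple without one stays without one, and every cubic square of the final graph consists of original
vertices, which the loops have visited. -/
theorem reduction_runs (I : Instance 1 1) (hI : I.graph ∈ classG2 I.order) :
    ∃ (s : Store) (t : ℕ), Runs .reduction I.toStore s t ∧
      t ≤ (forAllTime Prog.reduceSquare.bound 8).eval I.order + 4 ∧
      ((s.reg 1 = 0 ∧ ¬ I.IsYes) ∨
       (s.reg 1 = 2 ∧ ∃ G, s.Encodes G ∧ (s.IsYes G ↔ I.IsYes) ∧ s.reg 0 ≤ I.order + 2 * t ∧
          ∀ v₁ v₂ v₃ v₄ u₁ u₂ u₃ u₄, ¬ IsCubicSquare G v₁ v₂ v₃ v₄ u₁ u₂ u₃ u₄)) := by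
  let L := [3, 4, 5, 6, 7, 8, 9, 10]
  let Inv (s : Store) : Prop := s.reg 2 = I.order ∧
    ((s.reg 1 = 0 ∧ ¬ I.IsYes) ∨ (s.reg 1 = 2 ∧ ∃ G, s.Encodes G ∧ (s.IsYes G ↔ I.IsYes)))
  let R (t : ℕ) (s s' : Store) : Prop := s'.reg 0 ≤ s.reg 0 + 2 * t ∧
    (s'.reg 1 = 2 → s.reg 1 = 2 ∧ ∀ G', s'.Encodes G' → ∃ G, s.Encodes G ∧
      ∀ v₁ v₂ v₃ v₄ u₁ u₂ u₃ u₄, IsCubicSquare G' v₁ v₂ v₃ v₄ u₁ u₂ u₃ u₄ →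
        IsCubicSquare G v₁ v₂ v₃ v₄ u₁ u₂ u₃ u₄)
  let Q (f : ℕ → ℕ) (s : Store) : Prop := s.reg 1 = 2 → ∀ G, s.Encodes G →
    ¬ IsCubicSquare G (f 3) (f 4) (f 5) (f 6) (f 7) (f 8) (f 9) (f 10)
  have hL : ∀ x ∈ L, 3 ≤ x := by simp [L]
  have hreg : ∀ (s : Store) x c y, x ∈ L → y ≤ 2 → (s.setReg x c).reg y = s.reg y := by
    intro s x c y hx hy
    have := hL x hx
    simp only [Store.setReg]
    rw [if_neg (by omega)]
  have hEnc : ∀ (s : Store) x c G, x ∈ L → ((s.setReg x c).Encodes G ↔ s.Encodes G) := by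
    refine fun s x c G hx => ⟨fun h => h.congr rfl ?_, fun h => h.congr rfl ?_⟩
    exacts [(hreg s x c 0 hx (by omega)).symm, hreg s x c 0 hx (by omega)]
  set s₀ := (I.toStore.setReg 1 2).setReg 2 I.order
  have hs₀ : Inv s₀ := by
    refine ⟨by simp [s₀, Store.setReg], Or.inr ⟨by simp [s₀, Store.setReg], _,
      (encodes_toStore I hI).congr rfl (by simp [s₀, Store.setReg]), ?_⟩⟩
    exact (Store.IsYes.congr (s := I.toStore) (s' := s₀) _ rfl).trans (isYes_toStore I)
  have hInv : ∀ s x c, x ∈ L → Inv s → Inv (s.setReg x c) := by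
    rintro s x c hx ⟨hs2, hs⟩
    refine ⟨by rw [hreg s x c 2 hx le_rfl, hs2], ?_⟩
    simpa only [hreg s x c 1 hx (by omega), hEnc s x c _ hx,
      fun G => Store.IsYes.congr (s := s) (s' := s.setReg x c) G rfl] using hs
  have hRset : ∀ s x c t, x ∈ L → R t s (s.setReg x c) := by
    refine fun s x c t hx => ⟨by rw [hreg s x c 0 hx (by omega)]; omega, fun hs => ?_⟩
    exact ⟨by rwa [hreg s x c 1 hx (by omega)] at hs, fun G' hG' => ⟨G', (hEnc s x c _ hx).1 hG',
      fun _ _ _ _ _ _ _ _ h => h⟩⟩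
  have hRtrans : ∀ s s' s'' t t', R t s s' → R t' s' s'' → R (t + t') s s'' := by
    rintro s s' s'' t t' ⟨a1, a2⟩ ⟨b1, b2⟩
    refine ⟨by omega, fun hs => ?_⟩
    obtain ⟨hs', b3⟩ := b2 hs
    obtain ⟨hs'', a3⟩ := a2 hs'
    refine ⟨hs'', fun G'' hG'' => ?_⟩
    obtain ⟨G', hG', h'⟩ := b3 G'' hG''
    obtain ⟨G, hG, h⟩ := a3 G' hG'
    exact ⟨G, hG, fun _ _ _ _ _ _ _ _ hsq => h _ _ _ _ _ _ _ _ (h' _ _ _ _ _ _ _ _ hsq)⟩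
  have hQ : ∀ f s s' t, R t s s' → Q f s → Q f s' := by
    rintro f s s' t ⟨-, h⟩ hQ hs' G' hG' hsq
    obtain ⟨hs, h⟩ := h hs'
    obtain ⟨G, hG, h⟩ := h G' hG'
    exact hQ hs G hG (h _ _ _ _ _ _ _ _ hsq)
  have hP : ∀ s, Inv s → ∃ s' t, Runs .reduceSquare s s' t ∧ t ≤ Prog.reduceSquare.bound ∧ Inv s' ∧
      R t s s' ∧ (∀ y ∈ L, s'.reg y = s.reg y) ∧ ∀ f : ℕ → ℕ, (∀ y ∈ L, f y = s.reg y) → Q f s' := by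
    rintro s ⟨hs2, hs⟩
    obtain ⟨t, r1, r2, r3⟩ := Prog.loopFree_reduceSquare.runs s
    obtain ⟨o1, o2⟩ := reduceSquare_out_reg s
    refine ⟨_, t, r1, r3, ?_⟩
    rcases hs with ⟨hs1, hno⟩ | ⟨hs1, G, hG, hyes⟩
    · have : Prog.reduceSquare.out s = s := by
        simp [Prog.reduceSquare, Prog.out, Expr.eval, hs1]
      rw [this]
      exact ⟨⟨hs2, Or.inl ⟨hs1, hno⟩⟩, ⟨by omega, fun h => by omega⟩, fun _ _ => rfl,
        fun _ _ h => by omega⟩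
    · rcases reduceSquare_out hG hs1 with ⟨hs1', hno⟩ | ⟨hs1', G', hG', hyes', hmono, hsq⟩
      · exact ⟨⟨by rw [o2 2 le_rfl, hs2], Or.inl ⟨hs1', fun h => hno (hyes.2 h)⟩⟩,
          ⟨by omega, fun h => by omega⟩, fun y hy => o2 y (by have := hL y hy; omega),
          fun _ _ h => by omega⟩
      · refine ⟨⟨by rw [o2 2 le_rfl, hs2], Or.inr ⟨hs1', G', hG', hyes'.trans hyes⟩⟩,
          ⟨by omega, fun _ => ⟨hs1, fun G'' hG'' => ⟨G, hG, ?_⟩⟩⟩,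
          fun y hy => o2 y (by have := hL y hy; omega), fun f hf _ G'' hG'' => ?_⟩
        · rwa [hG''.unique hG']
        · simp only [L, List.forall_mem_cons] at hf
          obtain ⟨f3, f4, f5, f6, f7, f8, f9, f10, -⟩ := hf
          rwa [hG''.unique hG', f3, f4, f5, f6, f7, f8, f9, f10]
  obtain ⟨s, t, h1, h2, h3, h4, -, h6⟩ := forAll_runs (N := 2) (n := I.order)
    (B := Prog.reduceSquare.bound) (P := .reduceSquare) (L := L) (by simp [L]) (Inv := Inv) (R := R)
    (Q := Q) (fun s hs => hs.1) hInv hRset hRtrans hQ hP L (by simp [L]) (fun _ hx => hx) s₀ hs₀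
  refine ⟨s, _, .seq (.set 1 _ _) (.seq (.set 2 _ _) h1), ?_, ?_⟩
  · have : t ≤ (forAllTime Prog.reduceSquare.bound 8).eval I.order := h2
    simp only [Expr.cost]
    omega
  · refine h3.2.imp id ?_
    rintro ⟨hs1, G, hG, hyes⟩
    have h40 : s.reg 0 ≤ I.order + 2 * t := h4.1
    refine ⟨hs1, G, hG, hyes, by omega, fun v₁ v₂ v₃ v₄ u₁ u₂ u₃ u₄ hsq => ?_⟩
    obtain ⟨G₀, hG₀, hmono⟩ := (h4.2 hs1).2 G hG
    have hsq₀ := hmono _ _ _ _ _ _ _ _ hsq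
    have hlt : ∀ x y, G₀.Adj x y → x < I.order := hG₀.lt
    let f : ℕ → ℕ := fun x => [0, 0, 0, v₁, v₂, v₃, v₄, u₁, u₂, u₃, u₄].getD x 0
    refine h6 f ?_ ?_ hs1 G hG hsq
    · simp only [L, List.forall_mem_cons]
      exact ⟨hlt _ _ hsq₀.adj₁, hlt _ _ hsq₀.adj₂, hlt _ _ hsq₀.adj₃, hlt _ _ hsq₀.adj₄,
        hlt _ _ hsq₀.adj₁.symm, hlt _ _ hsq₀.adj₂.symm, hlt _ _ hsq₀.adj₃.symm,
        hlt _ _ hsq₀.adj₄.symm, by simp⟩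
    · exact fun y hy hy' => absurd hy hy'

end ClusterEditing

theorem mainTheorem3 :
    ClusterEditing.PolyReducible 1 1 ClusterEditing.classG2 ClusterEditing.classG3 := by
  open ClusterEditing in
  refine ⟨.reduction, .X + 2 * (forAllTime Prog.reduceSquare.bound 8 + 4), fun I hI => ?_⟩
  obtain ⟨s, t, hrun, ht, h⟩ := reduction_runs I hI
  have heval : (.X + 2 * (forAllTime Prog.reduceSquare.bound 8 + 4) : Polynomial ℕ).eval I.order =
      I.order + 2 * ((forAllTime Prog.reduceSquare.bound 8).eval I.order + 4) := by
    simp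
  rw [heval]
  refine ⟨s, t, hrun, by omega, ?_⟩
  rcases h with h | ⟨hs, G, hG, hyes, hord, hsq⟩
  · exact Or.inl h
  · refine Or.inr (Or.inr ⟨hs, s.toInstance G, hG.contains_toInstance,
      hG.toInstance_mem_classG3 hsq, ?_, hyes.symm.trans hG.isYes_toInstance.symm⟩)
    change s.reg 0 ≤ _
    omega
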